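/- **Model.** Let $n,d,a$ be integers with $d\ge 2$, $d<n$, $0\le a<n$, and put $p=a/n$. A *$d$-regular digraph* is a directed graph without loops or multiple edges in which every node has exactly $d$ out-neighbours and exactly $d$ in-neighbours. Let $G$ be a uniformly random $d$-regular digraph on $V=\{1,\dots,n\}$, let $V_A\subset V$ (the spies) be an independent, uniformly random set of $a=pn$ nodes, and let $V_H=V\setminus V_A$ (the honest nodes), $\tilde n=|V_H|=(1-p)n$. There are $\tilde n$ messages; the ground truth is a uniformly random bijection $v\mapsto X_v$ from $V_H$ to the set $\mathcal X$ of messages. *Flooding.* Each $v\in V_H$ broadcasts $X_v$. One time unit after a node (honest or spy) has first received a message, or its source has started it, the message is delivered to all its out-neighbours. Starting times are unknown to the adversary. Whenever an honest node $v$ delivers a message $x$ to a spy $u$ at the time at which $u$ first receives $x$, the triple $(x,u,T_u(x))$ is recorded in the log $S_v$, where $T_u(x)$ is counted from the first reception of $x$ by any spy; simultaneous first deliveries are all recorded. *Dynamic graph.* The adversary observes $\mathbf O=\big((S_v)_{v\in V_H},V_A,\Gamma(V_A)\big)$, where $\Gamma(V_A)$ is the set of all edges entering or leaving a spy, and knows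 nothing else about $G$ (it knows the distribution). A strategy $\mathtt M$ is a function of $\mathbf O$ that assigns to each message $x\in\mathcal X$ an honest node $\mathtt M(x)$. *Precision.* For $v\in V_H$ let $$D_{\mathtt M}(v)=\frac{\mathbf 1\{\mathtt M(X_v)=v\}}{\sum_{w\in V_H}\mathbf 1\{\mathtt M(X_w)=v\}}\qquad (0/0:=0),$$ and let $$\mathbf D_{\mathtt M}=\mathbb E\Big[\frac1{\tilde n}\sum_{v\in V_H}D_{\mathtt M}(v)\Big],\qquad \mathbf D_{\mathtt{OPT}}=\sup_{\mathtt M}\mathbf D_{\mathtt M}.$$ **Proposition.** For every $d\ge 2$ there is a constant $c>0$, depending only on $d$, such that for all $n>d$ and all $p\in[0,1)$ for which $pn$ is an integer, flooding on dynamic $d$-regular digraphs satisfies $\mathbf D_{\mathtt{OPT}}\ge c\,p$. -/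

import Mathlib

open scoped BigOperators

namespace FloodingAnonymity

noncomputable section

/-- `d`-regular digraph: no loops, every node has exactly `d` out-neighbours and exactly `d`
in-neighbours. -/
structure IsRegular {n : ℕ} (G : Digraph (Fin n)) (d : ℕ) : Prop where
  loopless : ∀ v, ¬ G.Adj v v
  outDegree : ∀ v, {w | G.Adj v w}.ncard = d
  inDegree : ∀ v, {w | G.Adj w v}.ncard = d

open Classical in
/-- The finite set of all labelled `d`-regular digraphs on `n` nodes. -/
def regularDigraphs (n d : ℕ) : Finset (Digraph (Fin n)) :=
  Finset.univ.filter fun G => IsRegular G d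

/-- Flooding: `Reached G s t v` says that, `t` rounds after the source `s` starts broadcasting,
node `v` has received the message. Each node that has the message passes it to all its
out-neighbours with a fixed delay, which is the unit of time. All nodes take part, spies too. -/
def Reached {n : ℕ} (G : Digraph (Fin n)) (s : Fin n) : ℕ → Fin n → Prop
  | 0, v => v = s
  | t + 1, v => Reached G s t v ∨ ∃ u, Reached G s t u ∧ G.Adj u v

/-- Node `v` receives the message of `s` for the first time exactly `t` rounds after its start. -/
def ReceivedAt {n : ℕ} (G : Digraph (Fin n)) (s v : Fin n) (t : ℕ) : Prop :=
  Reached G s t v ∧ ∀ t' < t, ¬ Reached G s t' v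

/-- `t` is the first time at which some spy receives the message of `s`. -/
def FirstSpyTime {n : ℕ} (G : Digraph (Fin n)) (S : Finset (Fin n)) (s : Fin n) (t : ℕ) : Prop :=
  (∃ u ∈ S, ReceivedAt G s u t) ∧ ∀ u ∈ S, ∀ t', ReceivedAt G s u t' → t ≤ t'

/-- The ground truth: a bijection `v ↦ X_v` from the honest nodes (those outside the set `S` of
spies) to the messages. -/
abbrev GroundTruth {n : ℕ} (S : Finset (Fin n)) (m : ℕ) : Type :=
  {v : Fin n // v ∉ S} ≃ Fin m

/-- What the adversary observes, with `m` messages on `n` nodes. -/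
structure Observation (n m : ℕ) where
  /-- the set of spies -/
  spies : Finset (Fin n)
  /-- the local neighbourhood of the spies: all edges that enter or leave a spy -/
  localEdges : Set (Fin n × Fin n)
  /-- the logs: `(x, u, r) ∈ log v` says that the honest node `v` delivered message `x` to the
  spy `u` at time `r` -/
  log : Fin n → Set (Fin m × Fin n × ℕ)

/-- The observation on the network `G` with spies `S` and ground truth `X`.
A delivery of `x` by `v` to `u` is logged if it is the first reception of `x` by `u` (all
simultaneous first deliveries are logged). Starting times are unknown to the adversary, so the
timestamps of a message `x` are counted from the first reception of `x` by a spy. -/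
def observe {n m : ℕ} (G : Digraph (Fin n)) (S : Finset (Fin n)) (X : GroundTruth S m) :
    Observation n m where
  spies := S
  localEdges := {e | G.Adj e.1 e.2 ∧ (e.1 ∈ S ∨ e.2 ∈ S)}
  log v := {y | v ∉ S ∧ y.2.1 ∈ S ∧ G.Adj v y.2.1 ∧
    ∃ t t₀ : ℕ, ReceivedAt G (X.symm y.1) v t ∧ ReceivedAt G (X.symm y.1) y.2.1 (t + 1) ∧
      FirstSpyTime G S (X.symm y.1) t₀ ∧ t + 1 = t₀ + y.2.2}

/-- A mapping strategy of the adversary: from the observation alone it assigns a node to each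
message; on every network that can occur, the assigned nodes are honest.
(Randomised strategies have the same optimal expected precision.) -/
def Strategy (n d a : ℕ) : Type :=
  {M : Observation n (n - a) → Fin (n - a) → Fin n //
    ∀ G ∈ regularDigraphs n d, ∀ S ∈ Finset.powersetCard a (Finset.univ : Finset (Fin n)),
      ∀ (X : GroundTruth S (n - a)) (x : Fin (n - a)), M (observe G S X) x ∉ S}

open Classical in
/-- Precision of the mapping `f` at the honest node `v`: the indicator of `f (X_v) = v` divided
by the number of messages mapped to `v` (and `0` if there are none). -/
def precisionAt {n m : ℕ} {S : Finset (Fin n)} (X : GroundTruth S m) (f : Fin m → Fin n)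
    (v : {v : Fin n // v ∉ S}) : ℝ :=
  (if f (X v) = v then 1 else 0) /
    ((Finset.univ.filter fun w : {w : Fin n // w ∉ S} => f (X w) = v).card : ℝ)

/-- Macro-averaged precision of `f`: the average over the honest nodes. -/
def precision {n m : ℕ} {S : Finset (Fin n)} (X : GroundTruth S m) (f : Fin m → Fin n) : ℝ :=
  (∑ v : {v : Fin n // v ∉ S}, precisionAt X f v) / (m : ℝ)

/-- Expected precision of a strategy. The `d`-regular digraph `G`, the set `S` of `a` spies and
the ground truth `X` are uniformly random, `G` and `S` independent, and `X` independent of `G`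
given `S`. -/
def expectedPrecision (n d a : ℕ) (M : Strategy n d a) : ℝ :=
  𝔼 G ∈ regularDigraphs n d, 𝔼 S ∈ Finset.powersetCard a (Finset.univ : Finset (Fin n)),
    𝔼 X : GroundTruth S (n - a), precision X (M.1 (observe G S X))

/-- The optimal precision of flooding on dynamic `d`-regular digraphs with `n` nodes, `a` of which
are spies. -/
def optimalPrecision (n d a : ℕ) : ℝ :=
  ⨆ M : Strategy n d a, expectedPrecision n d a M

end

end FloodingAnonymity

namespace FloodingAnonymity

open scoped Classical

noncomputable section

/-! ### Flooding: reachability, reversal, growth of balls -/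

section

variable {n d : ℕ} {G : Digraph (Fin n)}

/-! If $n$ is bounded or there is at most one spy, a bijective guess that ignores the logs suffices
(`one_div_le_optimalPrecision`). If $p\ge 1/(16d)$, it suffices to name a node that delivered to the
first spy: a source with a spy among its out-neighbours is then found, which has probability at
least $p/2$, and $1/k\ge 2\beta-\beta^2k$ with $\beta=p/2$ turns this into precision $p^2/4$
(`sq_le_optimalPrecision`).

For small $p$ the quadratic bound is too weak, because a node may also be named for many messages
that merely pass through it. The remedy is to reserve one spy $y$ as a clock. Let $16d^{2s}\le n\le
16d^{2s+2}$. If $v$ is the source and delivers to another spy at once, then typically $y$ is not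
reached before round $2s$. If instead the source is more than 30 steps away from $v$, the message
was 30 rounds earlier at some node $w$ from which $v$ can be reached in 30 rounds. Typically such
$w$ reach $y$ within $2s+29$ rounds, so $y$ hears the message less than $2s$ rounds after $v$, and
the clock rejects $v$ (`Candidate.reached`). Thus at most $2d^{30}$ messages are mapped to $v$, and
its precision is at least $1/(2d^{30})$ with probability of order $p$ (`mul_le_optimalPrecision`).

What remains is that a distance exceeds $2s+29$ with probability at most $1/(32d^{30})$, small
enough for a union bound over the nodes within 30 steps of $v$ (`card_not_reached_mul_le`). This
follows from switchings. Balls of radius $s+14$ typically have a boundary of full order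
(`card_small_layer_le`), and digraphs with no edge from the forward ball of $w$ to the backward ball
of $y$ are rare compared with those having two such edges (`card_level_zero_le`). Conditioning on an
edge from $v$ to a spy is handled by exchangeability of the labels (`card_mul_eq_sum_of_relabel`).
-/

theorem mem_regularDigraphs : G ∈ regularDigraphs n d ↔ IsRegular G d := by
  simp [regularDigraphs]

theorem Reached.succ {s v : Fin n} {t : ℕ} (h : Reached G s t v) : Reached G s (t + 1) v :=
  Or.inl h

theorem Reached.mono {s v : Fin n} {t t' : ℕ} (h : Reached G s t v) (htt : t ≤ t') :
    Reached G s t' v := by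
  induction htt with
  | refl => exact h
  | step _ ih => exact ih.succ

theorem Reached.step {s u v : Fin n} {t : ℕ} (h : Reached G s t u) (e : G.Adj u v) :
    Reached G s (t + 1) v :=
  Or.inr ⟨u, h, e⟩

theorem Reached.trans {s u v : Fin n} {t t' : ℕ} (h : Reached G s t u) (h' : Reached G u t' v) :
    Reached G s (t + t') v := by
  induction t' generalizing v with
  | zero => cases h'; exact h
  | succ t' ih =>
    rcases h' with h' | ⟨x, hx, e⟩
    · exact (ih h').succ
    · exact (ih hx).step e

theorem Reached.split {s v : Fin n} {t t' : ℕ} (h : Reached G s (t + t') v) :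
    ∃ u, Reached G s t u ∧ Reached G u t' v := by
  induction t' generalizing v with
  | zero => exact ⟨v, h, rfl⟩
  | succ t' ih =>
    rcases h with h | ⟨x, hx, e⟩
    · obtain ⟨u, h1, h2⟩ := ih h
      exact ⟨u, h1, h2.succ⟩
    · obtain ⟨u, h1, h2⟩ := ih hx
      exact ⟨u, h1, h2.step e⟩

theorem Reached.exists_receivedAt {s v : Fin n} {t : ℕ} (h : Reached G s t v) :
    ∃ t' ≤ t, ReceivedAt G s v t' := by
  have hex : ∃ t, Reached G s t v := ⟨t, h⟩
  exact ⟨Nat.find hex, Nat.find_le h, Nat.find_spec hex, fun t' ht' => Nat.find_min hex ht'⟩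

theorem ReceivedAt.exists_pred {s v : Fin n} {t : ℕ} (h : ReceivedAt G s v (t + 1)) :
    ∃ u, ReceivedAt G s u t ∧ G.Adj u v := by
  rcases h.1 with h1 | ⟨u, hu, e⟩
  · exact absurd h1 (h.2 t (Nat.lt_succ_self t))
  · refine ⟨u, ⟨hu, fun t' ht' h' => h.2 (_ + 1) (by omega) (h'.step e)⟩, e⟩

theorem receivedAt_zero {s v : Fin n} : ReceivedAt G s v 0 ↔ v = s :=
  ⟨fun h => h.1, fun h => ⟨h, fun _ ht' => absurd ht' (Nat.not_lt_zero _)⟩⟩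

/-- The reversed digraph. -/
def rev (G : Digraph (Fin n)) : Digraph (Fin n) := ⟨fun u v => G.Adj v u⟩

@[simp] theorem rev_adj {u v : Fin n} : (rev G).Adj u v ↔ G.Adj v u := Iff.rfl

theorem IsRegular.rev (h : IsRegular G d) : IsRegular (rev G) d :=
  ⟨h.loopless, h.inDegree, h.outDegree⟩

theorem Reached.rev {s v : Fin n} {t : ℕ} (h : Reached G s t v) :
    Reached (rev G) v t s := by
  induction t generalizing v with
  | zero => exact Eq.symm h
  | succ t ih =>
    rcases h with h | ⟨x, hx, e⟩
    · exact (ih h).succ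
    · have h1 : Reached (FloodingAnonymity.rev G) v 1 x := Reached.step (t := 0) rfl e
      have := h1.trans (ih hx)
      rwa [Nat.add_comm] at this

theorem reached_rev {s v : Fin n} {t : ℕ} : Reached (rev G) v t s ↔ Reached G s t v :=
  ⟨fun h => h.rev, fun h => h.rev⟩

/-- Nodes reached from `s` within `t` rounds. -/
def ball (G : Digraph (Fin n)) (s : Fin n) (t : ℕ) : Finset (Fin n) :=
  Finset.univ.filter fun v => Reached G s t v

/-- Nodes first reached from `s` in round `t`. -/
def layer (G : Digraph (Fin n)) (s : Fin n) (t : ℕ) : Finset (Fin n) :=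
  Finset.univ.filter fun v => ReceivedAt G s v t

/-- Out-neighbours. -/
def outN (G : Digraph (Fin n)) (v : Fin n) : Finset (Fin n) :=
  Finset.univ.filter fun w => G.Adj v w

/-- In-neighbours. -/
def inN (G : Digraph (Fin n)) (v : Fin n) : Finset (Fin n) :=
  Finset.univ.filter fun w => G.Adj w v

@[simp] theorem mem_ball {s v : Fin n} {t : ℕ} : v ∈ ball G s t ↔ Reached G s t v := by
  simp [ball]

@[simp] theorem mem_layer {s v : Fin n} {t : ℕ} : v ∈ layer G s t ↔ ReceivedAt G s v t := by
  simp [layer]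

@[simp] theorem mem_outN {u v : Fin n} : v ∈ outN G u ↔ G.Adj u v := by simp [outN]

@[simp] theorem mem_inN {u v : Fin n} : v ∈ inN G u ↔ G.Adj v u := by simp [inN]

theorem IsRegular.card_outN (h : IsRegular G d) (v : Fin n) : (outN G v).card = d := by
  rw [← h.outDegree v, ← Set.ncard_coe_finset]
  congr 1
  ext w
  simp

theorem IsRegular.card_inN (h : IsRegular G d) (v : Fin n) : (inN G v).card = d := by
  rw [← h.inDegree v, ← Set.ncard_coe_finset]
  congr 1
  ext w
  simp

theorem layer_subset_ball (s : Fin n) (t : ℕ) : layer G s t ⊆ ball G s t := by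
  intro v hv
  simp only [mem_layer, mem_ball] at *
  exact hv.1

theorem ball_succ (s : Fin n) (t : ℕ) :
    ball G s (t + 1) ⊆ insert s ((ball G s t).biUnion (outN G)) := by
  intro v hv
  obtain ⟨t', ht', h⟩ := Reached.exists_receivedAt (mem_ball.1 hv)
  cases t' with
  | zero => rw [receivedAt_zero] at h; simp [h]
  | succ t' =>
    obtain ⟨u, hu, e⟩ := h.exists_pred
    refine Finset.mem_insert_of_mem (Finset.mem_biUnion.2 ⟨u, ?_, mem_outN.2 e⟩)
    exact mem_ball.2 (hu.1.mono (by omega))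

/-- The summand 1 makes the induction close: a ball of size $b$ grows to at most $bd+1$, and
$bd+2\le (b+1)d$ since $d\ge 2$. -/
theorem card_ball_add_one_le (hd : 2 ≤ d) (h : IsRegular G d) (s : Fin n) (t : ℕ) :
    (ball G s t).card + 1 ≤ 2 * d ^ t := by
  induction t with
  | zero =>
    have : ball G s 0 = {s} := by ext v; simp [Reached]
    simp [this]
  | succ t ih =>
    have h1 : (ball G s (t + 1)).card ≤ (ball G s t).card * d + 1 := by
      refine (Finset.card_le_card (ball_succ s t)).trans ((Finset.card_insert_le _ _).trans ?_)
      gcongr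
      exact Finset.card_biUnion_le_card_mul _ _ _ fun v _ => (h.card_outN v).le
    have h2 : ((ball G s t).card + 1) * d ≤ 2 * d ^ t * d := Nat.mul_le_mul_right d ih
    rw [pow_succ]
    nlinarith

theorem card_ball_le (hd : 2 ≤ d) (h : IsRegular G d) (s : Fin n) (t : ℕ) :
    (ball G s t).card ≤ 2 * d ^ t :=
  (Nat.le_succ _).trans (card_ball_add_one_le hd h s t)

theorem card_layer_le (hd : 2 ≤ d) (h : IsRegular G d) (s : Fin n) (t : ℕ) :
    (layer G s t).card ≤ 2 * d ^ t :=
  (Finset.card_le_card (layer_subset_ball s t)).trans (card_ball_le hd h s t)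

/-- Flooding from `w` for `t` rounds only uses the edges leaving nodes reached before round `t`. -/
theorem reached_congr {G' : Digraph (Fin n)} {w : Fin n} {t : ℕ}
    (h : ∀ u s, s < t → Reached G w s u → ∀ v, G'.Adj u v ↔ G.Adj u v) {s : ℕ} (hs : s ≤ t)
    (v : Fin n) : Reached G' w s v ↔ Reached G w s v := by
  induction s generalizing v with
  | zero => exact Iff.rfl
  | succ s ih =>
    have ih' := ih (by omega)
    simp only [Reached]
    refine or_congr (ih' v) (exists_congr fun u => ?_)
    rw [ih' u]
    exact and_congr_right fun hu => h u s (by omega) hu v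

theorem ball_congr {G' : Digraph (Fin n)} {w : Fin n} {t : ℕ}
    (h : ∀ u s, s < t → Reached G w s u → ∀ v, G'.Adj u v ↔ G.Adj u v) :
    ball G' w t = ball G w t := by
  ext v
  simp [reached_congr h le_rfl v]

theorem layer_congr {G' : Digraph (Fin n)} {w : Fin n} {t : ℕ}
    (h : ∀ u s, s < t → Reached G w s u → ∀ v, G'.Adj u v ↔ G.Adj u v) :
    layer G' w t = layer G w t := by
  ext v
  simp only [mem_layer, ReceivedAt]
  rw [reached_congr h le_rfl v]
  exact and_congr_right fun _ => forall₂_congr fun t' ht' => by rw [reached_congr h ht'.le v]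

end

/-! ### Switchings and double counting -/

section

variable {n d : ℕ} {G : Digraph (Fin n)}

/-- Complement the adjacency relation on the block `{x, x'} × {z, z'}`. -/
def switch (G : Digraph (Fin n)) (x z x' z' : Fin n) : Digraph (Fin n) :=
  ⟨fun u v => if (u = x ∨ u = x') ∧ (v = z ∨ v = z') then ¬ G.Adj u v else G.Adj u v⟩

/-- The edges `x → z`, `x' → z'` can be replaced by `x → z'`, `x' → z`. -/
structure Switchable (G : Digraph (Fin n)) (x z x' z' : Fin n) : Prop where
  adj : G.Adj x z
  adj' : G.Adj x' z'
  not_adj : ¬ G.Adj x z'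
  not_adj' : ¬ G.Adj x' z
  ne : x ≠ z'
  ne' : x' ≠ z

theorem switch_adj {x z x' z' u v : Fin n} : (switch G x z x' z').Adj u v ↔
    if (u = x ∨ u = x') ∧ (v = z ∨ v = z') then ¬ G.Adj u v else G.Adj u v := Iff.rfl

theorem switch_adj_of_ne {x z x' z' u v : Fin n} (h : u ≠ x) (h' : u ≠ x') :
    (switch G x z x' z').Adj u v ↔ G.Adj u v := by
  rw [switch_adj, if_neg (by tauto)]

/-- Both switchings complement the same block. This makes the marked switchings recoverable from
their results, hence the double counting injective. -/
theorem switch_switch (x z x' z' : Fin n) : switch (switch G x z x' z') x z' x' z = G := by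
  ext u v
  rw [switch_adj, switch_adj]
  by_cases h1 : (u = x ∨ u = x') ∧ (v = z ∨ v = z')
  · rw [if_pos h1, if_pos (by tauto), not_not]
  · rw [if_neg h1, if_neg (by tauto)]

theorem rev_switch (x z x' z' : Fin n) :
    rev (switch G x z x' z') = switch (rev G) z x z' x' := by
  ext u v
  rw [rev_adj, switch_adj, switch_adj, rev_adj]
  by_cases h1 : (v = x ∨ v = x') ∧ (u = z ∨ u = z')
  · rw [if_pos h1, if_pos (by tauto)]
  · rw [if_neg h1, if_neg (by tauto)]

theorem Switchable.rev {x z x' z' : Fin n} (h : Switchable G x z x' z') :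
    Switchable (rev G) z x z' x' :=
  ⟨h.adj, h.adj', h.not_adj', h.not_adj, h.ne'.symm, h.ne.symm⟩

theorem Switchable.switch_adj_left {x z x' z' : Fin n} (h : Switchable G x z x' z') :
    (switch G x z x' z').Adj x z' := by
  rw [switch_adj, if_pos (by tauto)]; exact h.not_adj

theorem Switchable.switch_adj_right {x z x' z' : Fin n} (h : Switchable G x z x' z') :
    (switch G x z x' z').Adj x' z := by
  rw [switch_adj, if_pos (by tauto)]; exact h.not_adj'

/-- In the rows of $x$ and $x'$ exactly one of $z,z'$ is a neighbour, so complementing the block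
amounts to applying the transposition of $z$ and $z'$ to the out-neighbourhood. In-degrees follow by
reversal. -/
theorem Switchable.outDegree {x z x' z' : Fin n} (h : Switchable G x z x' z')
    (hG : ∀ v, {w | G.Adj v w}.ncard = d) (v : Fin n) :
    {w | (switch G x z x' z').Adj v w}.ncard = d := by
  by_cases hv : v = x ∨ v = x'
  · have : {w | (switch G x z x' z').Adj v w} = Equiv.swap z z' '' {w | G.Adj v w} := by
      ext w
      rw [Equiv.image_eq_preimage_symm, Equiv.symm_swap]
      simp only [Set.mem_ofPred_eq, Set.mem_preimage, switch_adj]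
      by_cases hz : w = z
      · subst hz
        rw [if_pos (by tauto), Equiv.swap_apply_left]
        rcases hv with rfl | rfl
        · exact ⟨fun h0 => absurd h.adj h0, fun h0 => absurd h0 h.not_adj⟩
        · exact ⟨fun _ => h.adj', fun _ => h.not_adj'⟩
      · by_cases hz' : w = z'
        · subst hz'
          rw [if_pos (by tauto), Equiv.swap_apply_right]
          rcases hv with rfl | rfl
          · exact ⟨fun _ => h.adj, fun _ => h.not_adj⟩
          · exact ⟨fun h0 => absurd h.adj' h0, fun h0 => absurd h0 h.not_adj'⟩
        · rw [if_neg (by tauto), Equiv.swap_apply_of_ne_of_ne hz hz']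
    rw [this, Set.ncard_image_of_injective _ (Equiv.injective _), hG]
  · rw [← hG v]
    congr 1
    ext w
    exact switch_adj_of_ne (by tauto) (by tauto)

theorem Switchable.isRegular {x z x' z' : Fin n} (h : Switchable G x z x' z')
    (hG : IsRegular G d) : IsRegular (switch G x z x' z') d := by
  refine ⟨fun v => ?_, h.outDegree hG.outDegree, fun v => ?_⟩
  · have h1 : x ≠ z := fun e => hG.loopless x (by have := h.adj; rwa [← e] at this)
    have h2 : x' ≠ z' := fun e => hG.loopless x' (by have := h.adj'; rwa [← e] at this)
    have h3 := h.ne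
    have h4 := h.ne'
    rw [switch_adj, if_neg]
    · exact hG.loopless v
    · rintro ⟨rfl | rfl, rfl | rfl⟩ <;> contradiction
  · have := h.rev.outDegree hG.rev.outDegree v
    rw [← rev_switch] at this
    exact this

/-- Double counting of switchings: if every marked switching of a regular digraph leads to a
marked reverse switching, there are at most as many of the former as of the latter. -/
theorem sum_card_le_of_switch {A B : Digraph (Fin n) → Finset (Fin n × Fin n × Fin n × Fin n)}
    (h : ∀ G, IsRegular G d → ∀ x z x' z', (x, z, x', z') ∈ A G →
      Switchable G x z x' z' ∧ (x, z', x', z) ∈ B (switch G x z x' z')) :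
    ∑ G ∈ regularDigraphs n d, (A G).card ≤ ∑ G ∈ regularDigraphs n d, (B G).card := by
  rw [← Finset.card_sigma, ← Finset.card_sigma]
  refine Finset.card_le_card_of_injOn
    (fun p => ⟨switch p.1 p.2.1 p.2.2.1 p.2.2.2.1 p.2.2.2.2,
      (p.2.1, p.2.2.2.2, p.2.2.2.1, p.2.2.1)⟩) ?_ ?_
  · rintro ⟨G, x, z, x', z'⟩ hp
    simp only [Finset.coe_sigma, Set.mem_sigma_iff, Finset.mem_coe, mem_regularDigraphs] at hp ⊢
    obtain ⟨h1, h2⟩ := h G hp.1 x z x' z' hp.2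
    exact ⟨h1.isRegular hp.1, h2⟩
  · rintro ⟨G, x, z, x', z'⟩ - ⟨G₂, x₂, z₂, x₂', z₂'⟩ - heq
    simp only [Sigma.mk.injEq, heq_eq_eq, Prod.mk.injEq] at heq
    obtain ⟨h0, rfl, rfl, rfl, rfl⟩ := heq
    have := congrArg (fun H => switch H x z' x' z) h0
    simp only [switch_switch] at this
    rw [this]

end

/-! ### Growth of layers in a random regular digraph -/

section

variable {n d : ℕ} {G : Digraph (Fin n)}

/-- Edges that leave a node of `S`. -/
def edgesFrom (G : Digraph (Fin n)) (S : Finset (Fin n)) : Finset (Fin n × Fin n) :=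
  Finset.univ.filter fun e => e.1 ∈ S ∧ G.Adj e.1 e.2

/-- Edges that enter a node of `S`. -/
def edgesTo (G : Digraph (Fin n)) (S : Finset (Fin n)) : Finset (Fin n × Fin n) :=
  Finset.univ.filter fun e => e.2 ∈ S ∧ G.Adj e.1 e.2

@[simp] theorem mem_edgesFrom {S : Finset (Fin n)} {e : Fin n × Fin n} :
    e ∈ edgesFrom G S ↔ e.1 ∈ S ∧ G.Adj e.1 e.2 := by simp [edgesFrom]

@[simp] theorem mem_edgesTo {S : Finset (Fin n)} {e : Fin n × Fin n} :
    e ∈ edgesTo G S ↔ e.2 ∈ S ∧ G.Adj e.1 e.2 := by simp [edgesTo]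

theorem IsRegular.card_edgesFrom (h : IsRegular G d) (S : Finset (Fin n)) :
    (edgesFrom G S).card = S.card * d := by
  have : edgesFrom G S = (S.sigma (outN G)).map (Equiv.sigmaEquivProd _ _).toEmbedding := by
    ext ⟨u, v⟩
    simp [Equiv.sigmaEquivProd]
  rw [this, Finset.card_map, Finset.card_sigma, Finset.sum_congr rfl fun v _ => h.card_outN v]
  simp

theorem edgesTo_eq_map (S : Finset (Fin n)) :
    edgesTo G S = (edgesFrom (rev G) S).map (Equiv.prodComm _ _).toEmbedding := by
  ext ⟨u, v⟩
  simp

theorem IsRegular.card_edgesTo (h : IsRegular G d) (S : Finset (Fin n)) :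
    (edgesTo G S).card = S.card * d := by
  rw [edgesTo_eq_map, Finset.card_map, h.rev.card_edgesFrom]

/-- Fibrewise lower bound for a set of quadruples. -/
theorem card_mul_le_card_quadruples {C : Finset (Fin n × Fin n)}
    {D : Fin n × Fin n → Finset (Fin n × Fin n)}
    {A : Finset (Fin n × Fin n × Fin n × Fin n)} {m k : ℕ}
    (h : ∀ p ∈ C, m ≤ k * (D p).card)
    (hA : ∀ p ∈ C, ∀ q ∈ D p, (p.1, p.2, q.1, q.2) ∈ A) : C.card * m ≤ k * A.card := by
  calc C.card * m = ∑ _p ∈ C, m := by simp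
    _ ≤ ∑ p ∈ C, k * (D p).card := Finset.sum_le_sum h
    _ = k * (C.sigma D).card := by rw [Finset.card_sigma, Finset.mul_sum]
    _ ≤ k * A.card := by
      gcongr
      refine Finset.card_le_card_of_injOn (fun s => (s.1.1, s.1.2, s.2.1, s.2.2)) ?_ ?_
      · intro s hs
        rw [Finset.mem_coe, Finset.mem_sigma] at hs
        exact hA _ hs.1 _ hs.2
      · rintro ⟨⟨a, b⟩, c, e⟩ - ⟨⟨a', b'⟩, c', e'⟩ - heq
        simp only [Prod.mk.injEq] at heq
        obtain ⟨rfl, rfl, rfl, rfl⟩ := heq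
        rfl

/-- Fibrewise upper bound for a set of quadruples. -/
theorem card_quadruples_le {C D : Finset (Fin n × Fin n)}
    {A : Finset (Fin n × Fin n × Fin n × Fin n)}
    (hA : ∀ x y z t, (x, y, z, t) ∈ A → (x, y) ∈ C ∧ (z, t) ∈ D) :
    A.card ≤ C.card * D.card := by
  rw [← Finset.card_product]
  refine Finset.card_le_card_of_injOn (fun s => ((s.1, s.2.1), (s.2.2.1, s.2.2.2))) ?_ ?_
  · rintro ⟨x, y, z, t⟩ hs
    simpa using hA x y z t hs
  · rintro ⟨a, b, c, e⟩ - ⟨a', b', c', e'⟩ - heq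
    simp only [Prod.mk.injEq] at heq
    obtain ⟨⟨rfl, rfl⟩, rfl, rfl⟩ := heq
    rfl

/-- Edges leaving layer `t` whose head is not a new node reached by this edge alone. -/
def collisions (G : Digraph (Fin n)) (w : Fin n) (t : ℕ) : Finset (Fin n × Fin n) :=
  (edgesFrom G (layer G w t)).filter fun e =>
    e.2 ∈ ball G w t ∨ ∃ x' ∈ layer G w t, x' ≠ e.1 ∧ G.Adj x' e.2

/-- An edge that is not a collision is determined by its head, which is new; so these edges inject
into the next layer. -/
theorem card_layer_succ (h : IsRegular G d) (w : Fin n) (t : ℕ) :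
    d * (layer G w t).card ≤ (layer G w (t + 1)).card + (collisions G w t).card := by
  have h1 : (edgesFrom G (layer G w t) \ collisions G w t).card ≤ (layer G w (t + 1)).card := by
    refine Finset.card_le_card_of_injOn Prod.snd ?_ ?_
    · rintro ⟨x, z⟩ hp
      simp only [collisions, Finset.coe_sdiff, Set.mem_sdiff, Finset.mem_coe, Finset.mem_filter,
        mem_edgesFrom, mem_layer, mem_ball] at hp ⊢
      obtain ⟨⟨hx, e⟩, hn⟩ := hp
      refine ⟨hx.1.step e, fun s hs hz => hn ⟨⟨hx, e⟩, Or.inl (hz.mono (by omega))⟩⟩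
    · rintro ⟨x, z⟩ hp ⟨x', z'⟩ hp' heq
      simp only [collisions, Finset.coe_sdiff, Set.mem_sdiff, Finset.mem_coe, Finset.mem_filter,
        mem_edgesFrom, mem_layer, mem_ball] at hp hp' heq
      subst heq
      by_contra hne
      refine hp.2 ⟨hp.1, Or.inr ⟨x', hp'.1.1, fun e => hne (by rw [e]), hp'.1.2⟩⟩
  have h2 : (collisions G w t).card + (edgesFrom G (layer G w t) \ collisions G w t).card
      = (edgesFrom G (layer G w t)).card := by
    rw [add_comm]
    exact Finset.card_sdiff_add_card_eq_card (Finset.filter_subset _ _)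
  rw [h.card_edgesFrom] at h2
  rw [mul_comm]
  omega

/-- Edges with which an edge `x → z` leaving layer `t` can be switched. -/
def partners (G : Digraph (Fin n)) (w : Fin n) (t : ℕ) (e : Fin n × Fin n) :
    Finset (Fin n × Fin n) :=
  edgesFrom G Finset.univ \ (edgesFrom G (ball G w t) ∪ edgesFrom G (inN G e.2) ∪
    edgesFrom G {e.2} ∪ edgesTo G (outN G e.1) ∪ edgesTo G {e.1})

theorem card_partners (hd : 2 ≤ d) (h : IsRegular G d) (w : Fin n) (t : ℕ) (e : Fin n × Fin n)
    (hn : 4 * d ^ t + 4 * d + 4 ≤ n) : n * d ≤ 2 * (partners G w t e).card := by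
  have h1 := Finset.le_card_sdiff (edgesFrom G (ball G w t) ∪ edgesFrom G (inN G e.2) ∪
    edgesFrom G {e.2} ∪ edgesTo G (outN G e.1) ∪ edgesTo G {e.1}) (edgesFrom G Finset.univ)
  have h2 : (edgesFrom G (ball G w t) ∪ edgesFrom G (inN G e.2) ∪
      edgesFrom G {e.2} ∪ edgesTo G (outN G e.1) ∪ edgesTo G {e.1}).card ≤
      (2 * d ^ t) * d + d * d + 1 * d + d * d + 1 * d := by
    refine (Finset.card_union_le _ _).trans (add_le_add ?_ ?_)
    · refine (Finset.card_union_le _ _).trans (add_le_add ?_ ?_)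
      · refine (Finset.card_union_le _ _).trans (add_le_add ?_ ?_)
        · refine (Finset.card_union_le _ _).trans (add_le_add ?_ ?_)
          · rw [h.card_edgesFrom]
            gcongr
            exact card_ball_le hd h w t
          · rw [h.card_edgesFrom, h.card_inN]
        · rw [h.card_edgesFrom, Finset.card_singleton]
      · rw [h.card_edgesTo, h.card_outN]
    · rw [h.card_edgesTo, Finset.card_singleton]
  rw [h.card_edgesFrom, Finset.card_univ, Fintype.card_fin] at h1
  have h3 : (4 * d ^ t + 4 * d + 4) * d ≤ n * d := Nat.mul_le_mul_right d hn
  have h4 : (4 * d ^ t + 4 * d + 4) * d =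
    2 * ((2 * d ^ t) * d + d * d + 1 * d + d * d + 1 * d) := by ring
  unfold partners
  omega

/-- Switch a collision $x\to z$ with one of at least $nd/2$ edges $x'\to z'$ whose tail lies outside
the ball. The first $t$ rounds are unaffected and $z$ stays in the ball of radius $t+1$, so the
result carries a marked edge leaving layer $t$ and a marked edge entering that ball. There are few
such pairs, independently of $n$. -/
theorem sum_card_collisions_le (hd : 2 ≤ d) (w : Fin n) (t : ℕ)
    (hn : 4 * d ^ t + 4 * d + 4 ≤ n) :
    n * ∑ G ∈ regularDigraphs n d, (collisions G w t).card ≤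
      8 * d ^ (2 * t + 2) * (regularDigraphs n d).card := by
  set A : Digraph (Fin n) → Finset (Fin n × Fin n × Fin n × Fin n) := fun G =>
    Finset.univ.filter fun s => (s.1, s.2.1) ∈ collisions G w t ∧
      (s.2.2.1, s.2.2.2) ∈ partners G w t (s.1, s.2.1) with hA
  set B : Digraph (Fin n) → Finset (Fin n × Fin n × Fin n × Fin n) := fun G =>
    Finset.univ.filter fun s => (s.1, s.2.1) ∈ edgesFrom G (layer G w t) ∧
      (s.2.2.1, s.2.2.2) ∈ edgesTo G (ball G w (t + 1)) with hB
  have key : ∑ G ∈ regularDigraphs n d, (A G).card ≤ ∑ G ∈ regularDigraphs n d, (B G).card := by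
    refine sum_card_le_of_switch fun G hG x z x' z' hs => ?_
    simp only [hA, Finset.mem_filter, Finset.mem_univ, true_and, partners, Finset.mem_sdiff,
      Finset.mem_union, not_or, mem_edgesFrom, mem_edgesTo, Finset.mem_singleton, mem_inN,
      mem_outN, mem_ball, collisions, mem_layer] at hs
    obtain ⟨⟨⟨hx, hxz⟩, hc⟩, hx'z', ⟨⟨⟨h1, h2⟩, h3⟩, h4⟩, h5⟩ := hs
    have hsw : Switchable G x z x' z' :=
      ⟨hxz, hx'z', fun h => h4 ⟨h, hx'z'⟩, fun h => h2 ⟨h, hx'z'⟩,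
        fun h => h5 ⟨h.symm, hx'z'⟩, fun h => h3 ⟨h, hx'z'⟩⟩
    have h1' : ¬ Reached G w t x' := fun h => h1 ⟨h, hx'z'⟩
    have hcong : ∀ u s, s < t → Reached G w s u → ∀ v,
        (switch G x z x' z').Adj u v ↔ G.Adj u v := by
      intro u s hs hu v
      refine switch_adj_of_ne ?_ ?_
      · rintro rfl; exact hx.2 s hs hu
      · rintro rfl; exact h1' (hu.mono hs.le)
    refine ⟨hsw, ?_⟩
    simp only [hB, Finset.mem_filter, Finset.mem_univ, true_and, mem_edgesFrom, mem_edgesTo]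
    refine ⟨⟨?_, hsw.switch_adj_left⟩, ?_, hsw.switch_adj_right⟩
    · rw [layer_congr hcong]; simpa using hx
    -- Either reason for the collision survives the switching: $z$ is still in the old ball, or is
    -- still hit by another node $y$ of the layer, whose out-edges are untouched.
    · rcases hc with hc | ⟨y, hy, hyx, hyz⟩
      · rw [mem_ball]
        refine Reached.succ ?_
        rwa [reached_congr hcong le_rfl]
      · rw [mem_ball]
        refine Reached.step (u := y) ?_ ?_
        · rw [reached_congr hcong le_rfl]; exact hy.1
        · rw [switch_adj_of_ne hyx (by rintro rfl; exact h1' hy.1)]; exact hyz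
  have hlow : ∀ G ∈ regularDigraphs n d, (collisions G w t).card * (n * d) ≤ 2 * (A G).card := by
    intro G hG
    rw [mem_regularDigraphs] at hG
    refine card_mul_le_card_quadruples (D := partners G w t)
      (fun p _ => card_partners hd hG w t p hn) fun p hp q hq => ?_
    simp only [hA, Finset.mem_filter, Finset.mem_univ, true_and]
    exact ⟨hp, hq⟩
  have hup : ∀ G ∈ regularDigraphs n d, (B G).card ≤ 4 * d ^ (2 * t + 2) * d := by
    intro G hG
    rw [mem_regularDigraphs] at hG
    refine (card_quadruples_le (C := edgesFrom G (layer G w t))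
      (D := edgesTo G (ball G w (t + 1))) fun x y z t h => ?_).trans ?_
    · simpa only [hB, Finset.mem_filter, Finset.mem_univ, true_and] using h
    · rw [hG.card_edgesFrom, hG.card_edgesTo]
      calc _ ≤ (2 * d ^ t * d) * (2 * d ^ (t + 1) * d) := by
            gcongr
            · exact card_layer_le hd hG w t
            · exact card_ball_le hd hG w (t + 1)
        _ = _ := by ring
  have h1 := Finset.sum_le_sum hlow
  have h2 := Finset.sum_le_sum hup
  rw [← Finset.sum_mul, ← Finset.mul_sum] at h1
  rw [Finset.sum_const, smul_eq_mul] at h2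
  have hd0 : 0 < d := by omega
  refine Nat.le_of_mul_le_mul_right (c := d) ?_ hd0
  calc n * (∑ G ∈ regularDigraphs n d, (collisions G w t).card) * d
      = (∑ G ∈ regularDigraphs n d, (collisions G w t).card) * (n * d) := by ring
    _ ≤ 2 * ((regularDigraphs n d).card * (4 * d ^ (2 * t + 2) * d)) := by omega
    _ = _ := by ring

/-- Number of nodes by which layer `r` falls short of `d ^ r`, bounded through the collisions. -/
def loss (d : ℕ) (G : Digraph (Fin n)) (w : Fin n) : ℕ → ℕ
  | 0 => 0
  | r + 1 => d * loss d G w r + (collisions G w r).card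

theorem pow_le_card_layer_add_loss (h : IsRegular G d) (w : Fin n) (r : ℕ) :
    d ^ r ≤ (layer G w r).card + loss d G w r := by
  induction r with
  | zero =>
    have : layer G w 0 = {w} := by ext v; simp [receivedAt_zero]
    simp [this]
  | succ r ih =>
    have h1 := card_layer_succ h w r
    have h2 := Nat.mul_le_mul_left d ih
    rw [mul_add] at h2
    rw [pow_succ', loss]
    omega

theorem sum_loss_le (hd : 2 ≤ d) (w : Fin n) (r : ℕ) (hn : 4 * d ^ r + 4 * d + 4 ≤ n) :
    n * ∑ G ∈ regularDigraphs n d, loss d G w r ≤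
      8 * d ^ (2 * r + 1) * (regularDigraphs n d).card := by
  induction r with
  | zero => simp [loss]
  | succ r ih =>
    have hn' : 4 * d ^ r + 4 * d + 4 ≤ n := by
      refine le_trans ?_ hn
      gcongr <;> omega
    have h1 := ih hn'
    have h2 := sum_card_collisions_le hd w r hn'
    simp only [loss, Finset.sum_add_distrib, ← Finset.mul_sum]
    set N := (regularDigraphs n d).card
    calc n * (d * ∑ G ∈ regularDigraphs n d, loss d G w r +
          ∑ G ∈ regularDigraphs n d, (collisions G w r).card)
        = d * (n * ∑ G ∈ regularDigraphs n d, loss d G w r) +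
          n * ∑ G ∈ regularDigraphs n d, (collisions G w r).card := by ring
      _ ≤ d * (8 * d ^ (2 * r + 1) * N) + 8 * d ^ (2 * r + 2) * N := by gcongr
      -- The inherited and the new loss have the same bound; the factor 2 is absorbed by $d$.
      _ = 8 * d ^ (2 * r + 2) * N * 2 := by ring
      _ ≤ 8 * d ^ (2 * r + 2) * N * d := by gcongr
      _ = _ := by ring

/-- Few regular digraphs have a small layer `r`. -/
theorem card_small_layer_le (hd : 2 ≤ d) (w : Fin n) (r : ℕ) (hn : 4 * d ^ r + 4 * d + 4 ≤ n) :
    n * ((regularDigraphs n d).filter fun G => 2 * (layer G w r).card < d ^ r).card ≤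
      16 * d ^ (r + 1) * (regularDigraphs n d).card := by
  have h1 := sum_loss_le hd w r hn
  set N := (regularDigraphs n d).card
  set Bad := (regularDigraphs n d).filter fun G => 2 * (layer G w r).card < d ^ r with hBad
  have h2 : Bad.card * d ^ r ≤ 2 * ∑ G ∈ regularDigraphs n d, loss d G w r := by
    calc Bad.card * d ^ r = ∑ _G ∈ Bad, d ^ r := by simp
      _ ≤ ∑ G ∈ Bad, 2 * loss d G w r := by
        refine Finset.sum_le_sum fun G hG => ?_
        rw [hBad, Finset.mem_filter, mem_regularDigraphs] at hG
        have := pow_le_card_layer_add_loss hG.1 w r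
        omega
      _ ≤ ∑ G ∈ regularDigraphs n d, 2 * loss d G w r :=
        Finset.sum_le_sum_of_subset (Finset.filter_subset _ _)
      _ = _ := by rw [Finset.mul_sum]
  have hpos : 0 < d ^ r := by positivity
  refine Nat.le_of_mul_le_mul_right (c := d ^ r) ?_ hpos
  calc n * Bad.card * d ^ r = n * (Bad.card * d ^ r) := by ring
    _ ≤ n * (2 * ∑ G ∈ regularDigraphs n d, loss d G w r) := by gcongr
    _ = 2 * (n * ∑ G ∈ regularDigraphs n d, loss d G w r) := by ring
    _ ≤ 2 * (8 * d ^ (2 * r + 1) * N) := by gcongr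
    _ = _ := by ring

end

/-! ### Edges between a forward and a backward ball -/

section

variable {n d : ℕ} {G : Digraph (Fin n)}

/-- Edges from the forward ball of radius `r` around `w` to the backward ball around `y`. -/
def cross (G : Digraph (Fin n)) (w y : Fin n) (r : ℕ) : Finset (Fin n × Fin n) :=
  (edgesFrom G (ball G w r)).filter fun e => e.2 ∈ ball (rev G) y r

theorem mem_cross {w y : Fin n} {r : ℕ} {e : Fin n × Fin n} : e ∈ cross G w y r ↔
    (e.1 ∈ ball G w r ∧ G.Adj e.1 e.2) ∧ e.2 ∈ ball (rev G) y r := by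
  simp [cross]

/-- The forward ball of `w` and the backward ball of `y` are disjoint, joined by `i` edges, and
have large boundaries. -/
structure Level (d : ℕ) (w y : Fin n) (r i : ℕ) (G : Digraph (Fin n)) : Prop where
  card_cross : (cross G w y r).card = i
  disj : Disjoint (ball G w r) (ball (rev G) y r)
  large : d ^ r ≤ 2 * (layer G w r).card
  large' : d ^ r ≤ 2 * (layer (rev G) y r).card

/-- Edges leaving the boundary of the forward ball that are not crossing. -/
def freeEdges (G : Digraph (Fin n)) (w y : Fin n) (r : ℕ) : Finset (Fin n × Fin n) :=
  edgesFrom G (layer G w r) \ cross G w y r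

/-- Edges with which the edge `e` can be switched so as to create a crossing edge. -/
def crossPartners (G : Digraph (Fin n)) (w y : Fin n) (r : ℕ) (e : Fin n × Fin n) :
    Finset (Fin n × Fin n) :=
  edgesTo G (layer (rev G) y r) \ (cross G w y r ∪ edgesFrom G {e.2} ∪ edgesFrom G (inN G e.2) ∪
    edgesTo G ((cross G w y r).image Prod.snd))

theorem Level.card_freeEdges {w y : Fin n} {r i : ℕ} (h : Level d w y r i G) (hG : IsRegular G d)
    (hi : i ≤ 1) (hr : 4 * d + 12 ≤ d ^ r) (hd : 2 ≤ d) :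
    d ^ (r + 1) ≤ 4 * (freeEdges G w y r).card := by
  have h1 := Finset.le_card_sdiff (cross G w y r) (edgesFrom G (layer G w r))
  rw [h.card_cross, hG.card_edgesFrom] at h1
  have h2 := Nat.mul_le_mul_right d h.large
  have h3 := Nat.mul_le_mul_right d hr
  rw [tsub_le_iff_right] at h1
  rw [pow_succ]
  unfold freeEdges
  nlinarith

theorem Level.card_crossPartners {w y : Fin n} {r i : ℕ} (h : Level d w y r i G)
    (hG : IsRegular G d) (hi : i ≤ 1) (hr : 4 * d + 12 ≤ d ^ r) (hd : 2 ≤ d)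
    (e : Fin n × Fin n) :
    d ^ (r + 1) ≤ 4 * (crossPartners G w y r e).card := by
  have h1 := Finset.le_card_sdiff (cross G w y r ∪ edgesFrom G {e.2} ∪ edgesFrom G (inN G e.2) ∪
    edgesTo G ((cross G w y r).image Prod.snd)) (edgesTo G (layer (rev G) y r))
  have h2 : (cross G w y r ∪ edgesFrom G {e.2} ∪ edgesFrom G (inN G e.2) ∪
    edgesTo G ((cross G w y r).image Prod.snd)).card ≤ 1 + 1 * d + d * d + 1 * d := by
    refine (Finset.card_union_le _ _).trans (add_le_add ?_ ?_)
    · refine (Finset.card_union_le _ _).trans (add_le_add ?_ ?_)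
      · refine (Finset.card_union_le _ _).trans (add_le_add ?_ ?_)
        · rw [h.card_cross]; exact hi
        · rw [hG.card_edgesFrom, Finset.card_singleton]
      · rw [hG.card_edgesFrom, hG.card_inN]
    · rw [hG.card_edgesTo]
      gcongr
      exact Finset.card_image_le.trans (h.card_cross.le.trans hi)
  rw [hG.card_edgesTo] at h1
  have h3 := Nat.mul_le_mul_right d h.large'
  have h4 := Nat.mul_le_mul_right d hr
  rw [tsub_le_iff_right] at h1
  rw [pow_succ]
  unfold crossPartners
  nlinarith

/-- Since neither $f\to x$ nor $z\to b$ crosses, $x$ lies outside the backward ball and $z$ outside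
the forward ball. The nodes $f$ and $b$ lie on the boundaries, so neither ball changes, and $f\to b$
is the only crossing edge gained; none is lost. -/
theorem Level.switch {w y f x z b : Fin n} {r i : ℕ} (h : Level d w y r i G)
    (h1 : (f, x) ∈ freeEdges G w y r) (h2 : (z, b) ∈ crossPartners G w y r (f, x)) :
    Switchable G f x z b ∧ Level d w y r (i + 1) (switch G f x z b) ∧
      (f, b) ∈ cross (switch G f x z b) w y r := by
  simp only [freeEdges, crossPartners, Finset.mem_sdiff, Finset.mem_union, not_or, mem_edgesFrom,
    mem_edgesTo, mem_inN, Finset.mem_singleton, mem_cross, mem_layer, mem_ball] at h1 h2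
  obtain ⟨⟨hf, hfx⟩, hx⟩ := h1
  obtain ⟨⟨hb, hzb⟩, ⟨⟨hz, hzx⟩, hzx'⟩, hfb⟩ := h2
  have hx' : ¬ Reached (rev G) y r x := fun h0 => hx ⟨⟨hf.1, hfx⟩, h0⟩
  have hz' : ¬ Reached G w r z := fun h0 => hz ⟨⟨h0, hzb⟩, hb.1⟩
  have hfb' : ¬ G.Adj f b := fun h0 => hfb
    ⟨Finset.mem_image.2 ⟨(f, b), mem_cross.2 ⟨⟨mem_ball.2 hf.1, h0⟩, mem_ball.2 hb.1⟩, rfl⟩, hzb⟩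
  have hne : f ≠ b := by
    rintro rfl
    exact Finset.disjoint_left.1 h.disj (mem_ball.2 hf.1) (mem_ball.2 hb.1)
  have hsw : Switchable G f x z b :=
    ⟨hfx, hzb, hfb', fun h0 => hzx' ⟨h0, hzb⟩, hne, fun h0 => hzx ⟨h0, hzb⟩⟩
  have hcong : ∀ u s, s < r → Reached G w s u → ∀ v,
      (FloodingAnonymity.switch G f x z b).Adj u v ↔ G.Adj u v := by
    intro u s hs hu v
    refine switch_adj_of_ne ?_ ?_
    · rintro rfl; exact hf.2 s hs hu
    · rintro rfl; exact hz' (hu.mono hs.le)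
  have hcong' : ∀ u s, s < r → Reached (rev G) y s u → ∀ v,
      (rev (FloodingAnonymity.switch G f x z b)).Adj u v ↔ (rev G).Adj u v := by
    intro u s hs hu v
    rw [rev_switch]
    refine switch_adj_of_ne ?_ ?_
    · rintro rfl; exact hx' (hu.mono hs.le)
    · rintro rfl; exact hb.2 s hs hu
  have hcross : cross (FloodingAnonymity.switch G f x z b) w y r
      = insert (f, b) (cross G w y r) := by
    ext ⟨u, v⟩
    rw [Finset.mem_insert, mem_cross, mem_cross, ball_congr hcong, ball_congr hcong', switch_adj]
    simp only [mem_ball, Prod.mk.injEq]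
    constructor
    · rintro ⟨⟨hu, he⟩, hv⟩
      by_cases hblk : (u = f ∨ u = z) ∧ (v = x ∨ v = b)
      · left
        refine ⟨hblk.1.resolve_right ?_, hblk.2.resolve_left ?_⟩
        · rintro rfl; exact hz' hu
        · rintro rfl; exact hx' hv
      · rw [if_neg hblk] at he
        exact Or.inr ⟨⟨hu, he⟩, hv⟩
    · rintro (⟨rfl, rfl⟩ | ⟨⟨hu, he⟩, hv⟩)
      · exact ⟨⟨hf.1, hsw.switch_adj_left⟩, hb.1⟩
      · refine ⟨⟨hu, ?_⟩, hv⟩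
        rw [if_neg]
        · exact he
        · rintro ⟨rfl | rfl, rfl | rfl⟩
          · exact hx' hv
          · exact hfb' he
          · exact hx' hv
          · exact hz' hu
  refine ⟨hsw, ⟨?_, ?_, ?_, ?_⟩, ?_⟩
  · rw [hcross, Finset.card_insert_of_notMem, h.card_cross]
    exact fun h0 => hfb' (mem_cross.1 h0).1.2
  · rw [ball_congr hcong, ball_congr hcong']; exact h.disj
  · rw [layer_congr hcong]; exact h.large
  · rw [layer_congr hcong']; exact h.large'
  · rw [hcross]; exact Finset.mem_insert_self _ _

/-- Level $i$ admits at least $(d^{r+1}/4)^2$ switchings upwards, while undoing one means choosing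
one of $i+1$ crossing edges and one of all $nd$ edges. -/
theorem card_level_mul_le (hd : 2 ≤ d) (w y : Fin n) (r i : ℕ) (hi : i ≤ 1)
    (hr : 4 * d + 12 ≤ d ^ r) :
    ((regularDigraphs n d).filter (Level d w y r i)).card * d ^ (2 * r + 1) ≤
      16 * ((i + 1) * n) * ((regularDigraphs n d).filter (Level d w y r (i + 1))).card := by
  set A : Digraph (Fin n) → Finset (Fin n × Fin n × Fin n × Fin n) := fun G =>
    Finset.univ.filter fun s => Level d w y r i G ∧ (s.1, s.2.1) ∈ freeEdges G w y r ∧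
      (s.2.2.1, s.2.2.2) ∈ crossPartners G w y r (s.1, s.2.1) with hA
  set B : Digraph (Fin n) → Finset (Fin n × Fin n × Fin n × Fin n) := fun G =>
    Finset.univ.filter fun s => Level d w y r (i + 1) G ∧ (s.1, s.2.1) ∈ cross G w y r ∧
      (s.2.2.1, s.2.2.2) ∈ edgesFrom G Finset.univ with hB
  have key : ∑ G ∈ regularDigraphs n d, (A G).card ≤ ∑ G ∈ regularDigraphs n d, (B G).card := by
    refine sum_card_le_of_switch fun G hG f x z b hs => ?_
    simp only [hA, Finset.mem_filter, Finset.mem_univ, true_and] at hs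
    obtain ⟨h0, h1, h2⟩ := hs
    obtain ⟨hsw, hl, hc⟩ := h0.switch h1 h2
    refine ⟨hsw, ?_⟩
    simp only [hB, Finset.mem_filter, Finset.mem_univ, true_and, mem_edgesFrom]
    exact ⟨hl, hc, hsw.switch_adj_right⟩
  have hlow : ((regularDigraphs n d).filter (Level d w y r i)).card * d ^ (2 * r + 2) ≤
      16 * ∑ G ∈ regularDigraphs n d, (A G).card := by
    calc _ = ∑ _G ∈ (regularDigraphs n d).filter (Level d w y r i), d ^ (2 * r + 2) := by simp
      _ ≤ ∑ G ∈ (regularDigraphs n d).filter (Level d w y r i), 16 * (A G).card := by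
        refine Finset.sum_le_sum fun G hG => ?_
        rw [Finset.mem_filter, mem_regularDigraphs] at hG
        obtain ⟨hG, hl⟩ := hG
        have h1 := hl.card_freeEdges hG hi hr hd
        have h2 : (freeEdges G w y r).card * d ^ (r + 1) ≤ 4 * (A G).card := by
          refine card_mul_le_card_quadruples (D := crossPartners G w y r)
            (fun p _ => hl.card_crossPartners hG hi hr hd p) fun p hp q hq => ?_
          simp only [hA, Finset.mem_filter, Finset.mem_univ, true_and]
          exact ⟨hl, hp, hq⟩
        calc d ^ (2 * r + 2) = d ^ (r + 1) * d ^ (r + 1) := by ring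
          _ ≤ 4 * (freeEdges G w y r).card * d ^ (r + 1) := by gcongr
          _ = 4 * ((freeEdges G w y r).card * d ^ (r + 1)) := by ring
          _ ≤ 4 * (4 * (A G).card) := by gcongr
          _ = _ := by ring
      _ ≤ ∑ G ∈ regularDigraphs n d, 16 * (A G).card :=
        Finset.sum_le_sum_of_subset (Finset.filter_subset _ _)
      _ = _ := by rw [Finset.mul_sum]
  have hup : ∑ G ∈ regularDigraphs n d, (B G).card ≤
      ((regularDigraphs n d).filter (Level d w y r (i + 1))).card * ((i + 1) * (n * d)) := by
    rw [← smul_eq_mul, ← Finset.sum_const, Finset.sum_filter]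
    refine Finset.sum_le_sum fun G hG => ?_
    rw [mem_regularDigraphs] at hG
    split_ifs with hl
    · refine (card_quadruples_le (C := cross G w y r) (D := edgesFrom G Finset.univ)
        fun x y z t h => ?_).trans ?_
      · simp only [hB, Finset.mem_filter, Finset.mem_univ, true_and] at h
        exact h.2
      · rw [hl.card_cross, hG.card_edgesFrom, Finset.card_univ, Fintype.card_fin]
    · rw [Nat.le_zero, Finset.card_eq_zero]
      simp [hB, hl]
  have hd0 : 0 < d := by omega
  refine Nat.le_of_mul_le_mul_right (c := d) ?_ hd0
  calc _ = ((regularDigraphs n d).filter (Level d w y r i)).card * d ^ (2 * r + 2) := by ring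
    _ ≤ 16 * (((regularDigraphs n d).filter (Level d w y r (i + 1))).card *
        ((i + 1) * (n * d))) := hlow.trans (by gcongr; exact key.trans hup)
    _ = _ := by ring

/-- Two levels are climbed because one gives only a probability of order $n/d^{2r+1}$. The later
union bound over a ball of radius about $2r+1-\log_d n$ would use that up; the square leaves room.
-/
theorem card_level_zero_le (hd : 2 ≤ d) (w y : Fin n) (r : ℕ) (hr : 4 * d + 12 ≤ d ^ r) :
    ((regularDigraphs n d).filter (Level d w y r 0)).card * d ^ (4 * r + 2) ≤
      512 * n ^ 2 * (regularDigraphs n d).card := by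
  have h0 := card_level_mul_le hd w y r 0 (by omega) hr
  have h1 := card_level_mul_le hd w y r 1 le_rfl hr
  have h2 : ((regularDigraphs n d).filter (Level d w y r 2)).card ≤ (regularDigraphs n d).card :=
    Finset.card_filter_le _ _
  calc _ = ((regularDigraphs n d).filter (Level d w y r 0)).card * d ^ (2 * r + 1) *
        d ^ (2 * r + 1) := by ring
    _ ≤ 16 * ((0 + 1) * n) * ((regularDigraphs n d).filter (Level d w y r (0 + 1))).card *
        d ^ (2 * r + 1) := by gcongr
    _ = 16 * n * (((regularDigraphs n d).filter (Level d w y r 1)).card * d ^ (2 * r + 1)) := by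
        ring_nf
    _ ≤ 16 * n * (16 * ((1 + 1) * n) *
        ((regularDigraphs n d).filter (Level d w y r (1 + 1))).card) := by gcongr
    _ ≤ 16 * n * (16 * ((1 + 1) * n) * (regularDigraphs n d).card) := by gcongr
    _ = _ := by ring

theorem level_zero_of_not_reached {w y : Fin n} {r : ℕ} (h : ¬ Reached G w (2 * r + 1) y)
    (h1 : d ^ r ≤ 2 * (layer G w r).card) (h2 : d ^ r ≤ 2 * (layer (rev G) y r).card) :
    Level d w y r 0 G := by
  refine ⟨?_, ?_, h1, h2⟩
  · rw [Finset.card_eq_zero, Finset.eq_empty_iff_forall_notMem]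
    rintro ⟨u, v⟩ he
    rw [mem_cross, mem_ball, mem_ball, reached_rev] at he
    refine h (Reached.mono ((he.1.1.step he.1.2).trans he.2) (by omega))
  · rw [Finset.disjoint_left]
    intro u hu hu'
    rw [mem_ball] at hu hu'
    rw [reached_rev] at hu'
    exact h ((hu.trans hu').mono (by omega))

/-- Reversal preserves the uniform distribution, which transfers the layer estimate to backward
balls. -/
theorem card_regularDigraphs_filter_rev (P : Digraph (Fin n) → Prop) [DecidablePred P] :
    ((regularDigraphs n d).filter fun G => P (rev G)).card =
      ((regularDigraphs n d).filter P).card := by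
  refine Finset.card_bij' (fun G _ => rev G) (fun G _ => rev G) ?_ ?_ ?_ ?_
  · intro G hG
    rw [Finset.mem_filter, mem_regularDigraphs] at hG ⊢
    exact ⟨hG.1.rev, hG.2⟩
  · intro G hG
    rw [Finset.mem_filter, mem_regularDigraphs] at hG ⊢
    exact ⟨hG.1.rev, hG.2⟩
  · intro G _; rfl
  · intro G _; rfl

/-- In most regular digraphs a given node is reached from another one within `2 * r + 1` rounds. -/
theorem card_not_reached_le (hd : 2 ≤ d) (w y : Fin n) (r : ℕ) (hr : 4 * d + 12 ≤ d ^ r)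
    (hn : 4 * d ^ r + 4 * d + 4 ≤ n) :
    n * d ^ (4 * r + 2) *
      ((regularDigraphs n d).filter fun G => ¬ Reached G w (2 * r + 1) y).card ≤
      (32 * d ^ (r + 1) * d ^ (4 * r + 2) + 512 * n ^ 3) * (regularDigraphs n d).card := by
  have h1 := card_small_layer_le hd w r hn
  have h2 := card_small_layer_le hd y r hn
  rw [← card_regularDigraphs_filter_rev fun G => 2 * (layer G y r).card < d ^ r] at h2
  have h3 := card_level_zero_le hd w y r hr
  set N := (regularDigraphs n d).card
  have h4 : ((regularDigraphs n d).filter fun G => ¬ Reached G w (2 * r + 1) y).card ≤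
      ((regularDigraphs n d).filter fun G => 2 * (layer G w r).card < d ^ r).card +
      ((regularDigraphs n d).filter fun G => 2 * (layer (rev G) y r).card < d ^ r).card +
      ((regularDigraphs n d).filter (Level d w y r 0)).card := by
    refine le_trans (Finset.card_le_card ?_) ((Finset.card_union_le _ _).trans
      (add_le_add_left (Finset.card_union_le _ _) _))
    intro G hG
    rw [Finset.mem_filter] at hG
    simp only [Finset.mem_union, Finset.mem_filter, hG.1, true_and]
    by_cases ha : 2 * (layer G w r).card < d ^ r
    · exact Or.inl (Or.inl ha)
    by_cases hb : 2 * (layer (rev G) y r).card < d ^ r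
    · exact Or.inl (Or.inr hb)
    exact Or.inr (level_zero_of_not_reached hG.2 (not_lt.1 ha) (not_lt.1 hb))
  set a := ((regularDigraphs n d).filter fun G => 2 * (layer G w r).card < d ^ r).card
  set b := ((regularDigraphs n d).filter fun G => 2 * (layer (rev G) y r).card < d ^ r).card
  set c := ((regularDigraphs n d).filter (Level d w y r 0)).card
  calc _ ≤ n * d ^ (4 * r + 2) * (a + b + c) := by gcongr
    _ = d ^ (4 * r + 2) * (n * a) + d ^ (4 * r + 2) * (n * b) + n * (c * d ^ (4 * r + 2)) := by
      ring
    _ ≤ d ^ (4 * r + 2) * (16 * d ^ (r + 1) * N) + d ^ (4 * r + 2) * (16 * d ^ (r + 1) * N) +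
      n * (512 * n ^ 2 * N) := by gcongr
    _ = _ := by ring

end

/-! ### Upper tail of the distance, with explicit constants -/

section

variable {n d : ℕ} {G : Digraph (Fin n)}

theorem card_not_reached_mul_le (hd : 2 ≤ d) {s : ℕ} (hs : 60 ≤ s) (hn : 16 * d ^ (2 * s) ≤ n)
    (hn' : n ≤ 16 * d ^ (2 * s + 2)) (w y : Fin n) :
    32 * d ^ 30 * ((regularDigraphs n d).filter fun G => ¬ Reached G w (2 * s + 29) y).card ≤
      (regularDigraphs n d).card := by
  have hd0 : 0 < d := by omega
  have pow_le : ∀ {a b : ℕ}, a ≤ b → d ^ a ≤ d ^ b := fun h => Nat.pow_le_pow_right hd0 h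
  have hr : 4 * d + 12 ≤ d ^ (s + 14) := by
    calc 4 * d + 12 ≤ 2 ^ 4 * d := by omega
      _ ≤ d ^ 4 * d := by gcongr
      _ = d ^ 5 := by ring
      _ ≤ _ := pow_le (by omega)
  have hr' : 4 * d ^ (s + 14) + 4 * d + 4 ≤ n := by
    have h1 : d ^ (s + 14) ≤ d ^ (2 * s) := pow_le (by omega)
    have h2 : d ≤ d ^ (2 * s) := Nat.le_self_pow (by omega) d
    have h3 : 1 ≤ d ^ (2 * s) := Nat.one_le_pow _ _ hd0
    omega
  have key := card_not_reached_le hd w y (s + 14) hr hr'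
  rw [show 2 * (s + 14) + 1 = 2 * s + 29 by ring] at key
  set N := (regularDigraphs n d).card
  set F := ((regularDigraphs n d).filter fun G => ¬ Reached G w (2 * s + 29) y).card
  -- The small-layer error and the crossing error each get half of the budget $1/(32d^{30})$. The
  -- first needs $s+52\le 2s$.
  have e1 : 2 * (32 * d ^ 30) * (32 * d ^ (s + 14 + 1)) ≤ n := by
    calc 2 * (32 * d ^ 30) * (32 * d ^ (s + 14 + 1)) = 16 * (2 ^ 7 * d ^ (s + 45)) := by ring
      _ ≤ 16 * (d ^ 7 * d ^ (s + 45)) := by gcongr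
      _ = 16 * d ^ (s + 52) := by ring
      _ ≤ 16 * d ^ (2 * s) := by gcongr; omega
      _ ≤ n := hn
  -- The radius $s+14$ is chosen here: the numerical constant is $2^{23}\le d^{23}$, and $4s+57\le
  -- 4(s+14)+2$.
  have e2 : 2 * (32 * d ^ 30) * (512 * n ^ 2) ≤ d ^ (4 * (s + 14) + 2) := by
    calc 2 * (32 * d ^ 30) * (512 * n ^ 2)
        ≤ 2 * (32 * d ^ 30) * (512 * (16 * d ^ (2 * s + 2)) ^ 2) := by gcongr
      _ = 2 ^ 23 * d ^ (4 * s + 34) := by ring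
      _ ≤ d ^ 23 * d ^ (4 * s + 34) := by gcongr
      _ = d ^ (4 * s + 57) := by ring
      _ ≤ _ := pow_le (by omega)
  have hM : 0 < n * d ^ (4 * (s + 14) + 2) := by
    have : 0 < 16 * d ^ (2 * s) := by positivity
    have : 0 < n := by omega
    positivity
  set P := d ^ (4 * (s + 14) + 2)
  refine Nat.le_of_mul_le_mul_left (c := 2 * (n * P)) ?_ (by positivity)
  calc 2 * (n * P) * (32 * d ^ 30 * F) = 2 * (32 * d ^ 30) * (n * P * F) := by ring
    _ ≤ 2 * (32 * d ^ 30) * ((32 * d ^ (s + 14 + 1) * P + 512 * n ^ 3) * N) := by gcongr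
    _ = ((2 * (32 * d ^ 30) * (32 * d ^ (s + 14 + 1))) * P +
        n * (2 * (32 * d ^ 30) * (512 * n ^ 2))) * N := by ring
    _ ≤ (n * P + n * P) * N := by gcongr
    _ = _ := by ring

end

/-! ### Exchangeability of node labels -/

section

variable {n d : ℕ} {G : Digraph (Fin n)}

/-- The digraph `G` with its nodes renamed by `π`. -/
def relabel (π : Equiv.Perm (Fin n)) (G : Digraph (Fin n)) : Digraph (Fin n) :=
  ⟨fun u v => G.Adj (π.symm u) (π.symm v)⟩

theorem relabel_adj {π : Equiv.Perm (Fin n)} {u v : Fin n} :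
    (relabel π G).Adj (π u) (π v) ↔ G.Adj u v := by
  simp [relabel]

theorem relabel_symm_relabel (π : Equiv.Perm (Fin n)) : relabel π.symm (relabel π G) = G := by
  ext u v
  simp [relabel]

theorem IsRegular.relabel (h : IsRegular G d) (π : Equiv.Perm (Fin n)) :
    IsRegular (relabel π G) d := by
  refine ⟨fun v => h.loopless _, fun v => ?_, fun v => ?_⟩
  · have : {w | (FloodingAnonymity.relabel π G).Adj v w} = π '' {w | G.Adj (π.symm v) w} := by
      ext w
      rw [Equiv.image_eq_preimage_symm]
      rfl
    rw [this, Set.ncard_image_of_injective _ π.injective, h.outDegree]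
  · have : {w | (FloodingAnonymity.relabel π G).Adj w v} = π '' {w | G.Adj w (π.symm v)} := by
      ext w
      rw [Equiv.image_eq_preimage_symm]
      rfl
    rw [this, Set.ncard_image_of_injective _ π.injective, h.inDegree]

theorem Reached.relabel {s v : Fin n} {t : ℕ} (h : Reached G s t v) (π : Equiv.Perm (Fin n)) :
    Reached (relabel π G) (π s) t (π v) := by
  induction t generalizing v with
  | zero => exact congrArg π h
  | succ t ih =>
    rcases h with h | ⟨x, hx, e⟩
    · exact (ih h).succ
    · exact (ih hx).step (relabel_adj.2 e)

theorem reached_relabel {s v : Fin n} {t : ℕ} (π : Equiv.Perm (Fin n)) :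
    Reached (relabel π G) (π s) t (π v) ↔ Reached G s t v := by
  refine ⟨fun h => ?_, fun h => h.relabel π⟩
  have := h.relabel π.symm
  rwa [relabel_symm_relabel, Equiv.symm_apply_apply, Equiv.symm_apply_apply] at this

/-- Nodes outside `Z` are exchangeable with respect to properties that are invariant under the
renamings that fix `Z`. -/
theorem card_mul_eq_sum_of_relabel {Q : Digraph (Fin n) → Fin n → Prop}
    [∀ G a, Decidable (Q G a)] {Z : Finset (Fin n)}
    (hQ : ∀ G π, (∀ z ∈ Z, π z = z) → ∀ a, Q G a → Q (relabel π G) (π a)) {a : Fin n}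
    (ha : a ∉ Z) :
    (n - Z.card) * ((regularDigraphs n d).filter fun G => Q G a).card =
      ∑ G ∈ regularDigraphs n d, (Finset.univ.filter fun b => b ∉ Z ∧ Q G b).card := by
  -- Renaming by the transposition of $a$ and $b$ fixes $Z$ and injects one event into the other.
  have hle : ∀ a b, a ∉ Z → b ∉ Z → ((regularDigraphs n d).filter fun G => Q G a).card ≤
      ((regularDigraphs n d).filter fun G => Q G b).card := by
    intro a b ha hb
    refine Finset.card_le_card_of_injOn (relabel (Equiv.swap a b)) ?_ ?_
    · intro G hG
      rw [Finset.mem_coe, Finset.mem_filter, mem_regularDigraphs] at hG ⊢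
      refine ⟨hG.1.relabel _, ?_⟩
      have := hQ G (Equiv.swap a b) (fun z hz => Equiv.swap_apply_of_ne_of_ne
        (by rintro rfl; exact ha hz) (by rintro rfl; exact hb hz)) a hG.2
      rwa [Equiv.swap_apply_left] at this
    · intro G _ G' _ h
      have := congrArg (relabel (Equiv.swap a b).symm) h
      simpa only [relabel_symm_relabel] using this
  have h1 : ∑ G ∈ regularDigraphs n d, (Finset.univ.filter fun b => b ∉ Z ∧ Q G b).card =
      ∑ b ∈ Finset.univ.filter (· ∉ Z), ((regularDigraphs n d).filter fun G => Q G b).card := by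
    simp_rw [Finset.card_filter]
    rw [Finset.sum_comm, Finset.sum_filter]
    refine Finset.sum_congr rfl fun b _ => ?_
    split_ifs with hb
    · simp [hb]
    · simp [hb]
  rw [h1, Finset.sum_congr rfl fun b hb => le_antisymm
    (hle b a (Finset.mem_filter.1 hb).2 ha) (hle a b ha (Finset.mem_filter.1 hb).2)]
  rw [Finset.sum_const, smul_eq_mul]
  congr 1
  have : Finset.univ.filter (· ∉ Z) = Zᶜ := by ext; simp
  rw [this, Finset.card_compl, Fintype.card_fin]

theorem card_adj {v u : Fin n} (h : u ≠ v) :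
    (n - 1) * ((regularDigraphs n d).filter fun G => G.Adj v u).card =
      d * (regularDigraphs n d).card := by
  have := card_mul_eq_sum_of_relabel (d := d) (Q := fun G a => G.Adj v a) (Z := {v}) (a := u) ?_
    (by simpa using h)
  · rw [Finset.card_singleton] at this
    rw [this, mul_comm, ← smul_eq_mul, ← Finset.sum_const]
    refine Finset.sum_congr rfl fun G hG => ?_
    rw [mem_regularDigraphs] at hG
    rw [← hG.card_outN v, outN]
    congr 1
    ext b
    simp only [Finset.mem_filter, Finset.mem_univ, true_and, Finset.mem_singleton]
    exact ⟨fun h => h.2, fun h => ⟨by rintro rfl; exact hG.loopless _ h, h⟩⟩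
  · intro G π hπ a ha
    have := relabel_adj (π := π).2 ha
    rwa [hπ v (by simp)] at this

/-- A third node is rarely reached early, also given an edge `v → u`. -/
theorem card_adj_reached_le (hd : 2 ≤ d) {v u y : Fin n} (hv : y ≠ v) (hu : y ≠ u) (huv : u ≠ v)
    (t : ℕ) :
    (n - 2) * ((regularDigraphs n d).filter fun G => G.Adj v u ∧ Reached G v t y).card ≤
      2 * d ^ t * ((regularDigraphs n d).filter fun G => G.Adj v u).card := by
  have := card_mul_eq_sum_of_relabel (d := d) (Q := fun G a => G.Adj v u ∧ Reached G v t a)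
    (Z := {u, v}) (a := y) ?_ (by simp [hv, hu])
  · rw [Finset.card_pair huv] at this
    rw [this, mul_comm, ← smul_eq_mul, ← Finset.sum_const, Finset.sum_filter]
    refine Finset.sum_le_sum fun G hG => ?_
    rw [mem_regularDigraphs] at hG
    split_ifs with h
    · refine (Finset.card_le_card fun b hb => ?_).trans (card_ball_le hd hG v t)
      simp only [Finset.mem_filter] at hb
      exact mem_ball.2 hb.2.2.2
    · simp [h]
  · intro G π hπ a ha
    have h1 := relabel_adj (π := π).2 ha.1
    have h2 := ha.2.relabel π
    rw [hπ v (by simp), hπ u (by simp)] at h1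
    rw [hπ v (by simp)] at h2
    exact ⟨h1, h2⟩

theorem card_adj_adj_le {v u s y : Fin n} (hv : y ≠ v) (hu : y ≠ u) (hs : y ≠ s) :
    (n - 3) * ((regularDigraphs n d).filter fun G => G.Adj v u ∧ G.Adj s y).card ≤
      d * ((regularDigraphs n d).filter fun G => G.Adj v u).card := by
  have := card_mul_eq_sum_of_relabel (d := d) (Q := fun G a => G.Adj v u ∧ G.Adj s a)
    (Z := {u, v, s}) (a := y) ?_ (by simp [hv, hu, hs])
  -- The node $s$ may coincide with $u$ or $v$, so only an upper bound for the size is available.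
  · have h3 : ({u, v, s} : Finset (Fin n)).card ≤ 3 := Finset.card_le_three
    refine (Nat.mul_le_mul_right _ (Nat.sub_le_sub_left h3 n)).trans ?_
    rw [this, mul_comm, ← smul_eq_mul, ← Finset.sum_const, Finset.sum_filter]
    refine Finset.sum_le_sum fun G hG => ?_
    rw [mem_regularDigraphs] at hG
    split_ifs with h
    · refine (Finset.card_le_card fun b hb => ?_).trans (hG.card_outN s).le
      simp only [Finset.mem_filter] at hb
      exact mem_outN.2 hb.2.2.2
    · simp [h]
  · intro G π hπ a ha
    have h1 := relabel_adj (π := π).2 ha.1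
    have h2 := relabel_adj (π := π).2 ha.2
    rw [hπ v (by simp), hπ u (by simp)] at h1
    rw [hπ s (by simp)] at h2
    exact ⟨h1, h2⟩

/-- Some node at distance at most `k` to `v` does not reach `y` within `m` rounds. -/
def FarAncestor (G : Digraph (Fin n)) (k m : ℕ) (v y : Fin n) : Prop :=
  ∃ w, Reached G w k v ∧ ¬ Reached G w m y

theorem FarAncestor.relabel {k m : ℕ} {v y : Fin n} (h : FarAncestor G k m v y)
    (π : Equiv.Perm (Fin n)) : FarAncestor (relabel π G) k m (π v) (π y) := by
  obtain ⟨w, h1, h2⟩ := h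
  exact ⟨π w, h1.relabel π, fun h => h2 ((reached_relabel π).1 h)⟩

/-- Averaging over $u$ replaces the edge by the out-degree $d$. Averaging over $v$ then charges each
$w$ that fails to reach $y$ with the nodes of its forward ball of radius $k$. -/
theorem card_adj_farAncestor_le (hd : 2 ≤ d) {v u y : Fin n} (hv : y ≠ v) (hu : y ≠ u)
    (huv : u ≠ v) (k m : ℕ) {c : ℕ} (hc : ∀ w,
      ((regularDigraphs n d).filter fun G => ¬ Reached G w m y).card ≤ c) :
    (n - 1) * ((n - 2) *
      ((regularDigraphs n d).filter fun G => G.Adj v u ∧ FarAncestor G k m v y).card) ≤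
      d * (2 * d ^ k * (n * c)) := by
  have h1 : (n - 2) *
      ((regularDigraphs n d).filter fun G => G.Adj v u ∧ FarAncestor G k m v y).card ≤
      d * ((regularDigraphs n d).filter fun G => FarAncestor G k m v y).card := by
    have := card_mul_eq_sum_of_relabel (d := d) (Q := fun G a => G.Adj v a ∧ FarAncestor G k m v y)
      (Z := {y, v}) (a := u) ?_ (by simp [huv, hu.symm])
    · rw [Finset.card_pair hv] at this
      rw [this, mul_comm, ← smul_eq_mul, ← Finset.sum_const, Finset.sum_filter]
      refine Finset.sum_le_sum fun G hG => ?_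
      rw [mem_regularDigraphs] at hG
      split_ifs with h
      · refine (Finset.card_le_card fun b hb => ?_).trans (hG.card_outN v).le
        simp only [Finset.mem_filter] at hb
        exact mem_outN.2 hb.2.2.1
      · simp [h]
    · intro G π hπ a ha
      have h1 := relabel_adj (π := π).2 ha.1
      have h2 := ha.2.relabel π
      rw [hπ v (by simp)] at h1
      rw [hπ v (by simp), hπ y (by simp)] at h2
      exact ⟨h1, h2⟩
  have h2 : (n - 1) * ((regularDigraphs n d).filter fun G => FarAncestor G k m v y).card ≤
      2 * d ^ k * (n * c) := by
    have := card_mul_eq_sum_of_relabel (d := d) (Q := fun G a => FarAncestor G k m a y)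
      (Z := {y}) (a := v) ?_ (by simp [hv.symm])
    · rw [Finset.card_singleton] at this
      rw [this]
      calc _ ≤ ∑ G ∈ regularDigraphs n d, ∑ w : Fin n,
            if ¬ Reached G w m y then 2 * d ^ k else 0 := by
            refine Finset.sum_le_sum fun G hG => ?_
            rw [mem_regularDigraphs] at hG
            calc _ ≤ ((Finset.univ.filter fun w => ¬ Reached G w m y).biUnion
                  fun w => ball G w k).card := by
                  refine Finset.card_le_card fun b hb => ?_
                  simp only [Finset.mem_filter] at hb
                  obtain ⟨w, h1, h2⟩ := hb.2.2
                  simp only [Finset.mem_biUnion, Finset.mem_filter, Finset.mem_univ, true_and,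
                    mem_ball]
                  exact ⟨w, h2, h1⟩
              _ ≤ ∑ w ∈ Finset.univ.filter fun w => ¬ Reached G w m y, (ball G w k).card :=
                  Finset.card_biUnion_le
              _ ≤ ∑ w ∈ Finset.univ.filter fun w => ¬ Reached G w m y, 2 * d ^ k :=
                  Finset.sum_le_sum fun w _ => card_ball_le hd hG w k
              _ = _ := by rw [Finset.sum_filter]
        _ = ∑ w : Fin n, ((regularDigraphs n d).filter fun G => ¬ Reached G w m y).card *
            (2 * d ^ k) := by
            rw [Finset.sum_comm]
            refine Finset.sum_congr rfl fun w _ => ?_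
            rw [← Finset.sum_filter, Finset.sum_const, smul_eq_mul]
        _ ≤ ∑ w : Fin n, c * (2 * d ^ k) := by
            refine Finset.sum_le_sum fun w _ => ?_
            gcongr
            exact hc w
        _ = _ := by simp; ring
    · intro G π hπ a ha
      have h2 := ha.relabel π
      rwa [hπ y (by simp)] at h2
  calc _ ≤ (n - 1) * (d * ((regularDigraphs n d).filter fun G => FarAncestor G k m v y).card) := by
        gcongr
    _ = d * ((n - 1) * ((regularDigraphs n d).filter fun G => FarAncestor G k m v y).card) := by
        ring
    _ ≤ _ := by gcongr

end

/-! ### Sources next to a spy, and typical behaviour of the clock spy -/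

section

variable {n d : ℕ} {G : Digraph (Fin n)}

/-- The node `v` has an out-neighbour among the spies other than `y`. -/
def Exposed (G : Digraph (Fin n)) (S : Finset (Fin n)) (y v : Fin n) : Prop :=
  ∃ u ∈ S, u ≠ y ∧ G.Adj v u

/-- The spy `y` is not reached from `v` too early, hears from honest nodes only, and is reached in
time from all nodes that are close to `v`. -/
structure Typical (G : Digraph (Fin n)) (S : Finset (Fin n)) (y v : Fin n) (s : ℕ) : Prop where
  late : ¬ Reached G v (2 * s - 1) y
  honest : ∀ t ∈ S, ¬ G.Adj t y
  near : ¬ FarAncestor G 30 (2 * s + 29) v y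

/-- Summing over the spies other than $y$ counts each digraph at most $d$ times, once per
out-neighbour of $v$ at most. -/
theorem mul_card_le_of_adj {S : Finset (Fin n)} {y v : Fin n} (hy : y ∈ S)
    {T : Digraph (Fin n) → Prop} {c m : ℕ}
    (h : ∀ u ∈ S, u ≠ y → c ≤ m * ((regularDigraphs n d).filter fun G => G.Adj v u ∧ T G).card) :
    (S.card - 1) * c ≤
      m * (d * ((regularDigraphs n d).filter fun G => Exposed G S y v ∧ T G).card) := by
  calc (S.card - 1) * c = ∑ _u ∈ S.erase y, c := by
        rw [Finset.sum_const, smul_eq_mul, Finset.card_erase_of_mem hy]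
    _ ≤ ∑ u ∈ S.erase y,
        m * ((regularDigraphs n d).filter fun G => G.Adj v u ∧ T G).card :=
      Finset.sum_le_sum fun u hu => h u (Finset.mem_of_mem_erase hu) (Finset.ne_of_mem_erase hu)
    _ = m * ∑ G ∈ regularDigraphs n d,
        ((S.erase y).filter fun u => G.Adj v u ∧ T G).card := by
      rw [← Finset.mul_sum]
      simp_rw [Finset.card_filter]
      rw [Finset.sum_comm]
    _ ≤ m * ∑ G ∈ regularDigraphs n d, if Exposed G S y v ∧ T G then d else 0 := by
      gcongr with G hG
      rw [mem_regularDigraphs] at hG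
      split_ifs with hE
      · refine (Finset.card_le_card fun u hu => ?_).trans (hG.card_outN v).le
        rw [Finset.mem_filter] at hu
        exact mem_outN.2 hu.2.1
      · rw [Nat.le_zero, Finset.card_eq_zero, Finset.filter_eq_empty_iff]
        rintro u hu ⟨h1, h2⟩
        exact hE ⟨⟨u, Finset.mem_of_mem_erase hu, Finset.ne_of_mem_erase hu, h1⟩, h2⟩
    _ = _ := by rw [← Finset.sum_filter, Finset.sum_const, smul_eq_mul]; ring

theorem card_exposed (hd : 2 ≤ d) {S : Finset (Fin n)} {y v : Fin n} (hy : y ∈ S) (hv : v ∉ S) :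
    (S.card - 1) * (regularDigraphs n d).card ≤
      (n - 1) * ((regularDigraphs n d).filter fun G => Exposed G S y v).card := by
  have h := mul_card_le_of_adj (d := d) (v := v) hy (T := fun _ => True)
    (c := d * (regularDigraphs n d).card) (m := n - 1) fun u hu _ => by
      rw [← card_adj (d := d) (v := v) (u := u) (by rintro rfl; exact hv hu)]
      simp
  simp only [and_true] at h
  refine Nat.le_of_mul_le_mul_left (c := d) ?_ (by omega)
  calc _ = (S.card - 1) * (d * (regularDigraphs n d).card) := by ring
    _ ≤ _ := h
    _ = _ := by ring

/-- Given the edge, each of the three ways to be atypical has probability at most $1/8$: the ball of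
radius $2s-1$ has at most $d^{2s}\le n/16$ nodes, the spies have few out-edges since $16d|S|\le n$,
and distances have the tail bound above. -/
theorem card_adj_le_typical (hd : 2 ≤ d) {s : ℕ} (hs : 60 ≤ s) (hn : 16 * d ^ (2 * s) ≤ n)
    (hn' : n ≤ 16 * d ^ (2 * s + 2)) {S : Finset (Fin n)} {y v u : Fin n} (hy : y ∈ S)
    (hv : v ∉ S) (hu : u ∈ S) (huy : u ≠ y) (hS : 16 * d * S.card ≤ n) :
    ((regularDigraphs n d).filter fun G => G.Adj v u).card ≤
      2 * ((regularDigraphs n d).filter fun G => G.Adj v u ∧ Typical G S y v s).card := by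
  have hyv : y ≠ v := by rintro rfl; exact hv hy
  have huv : u ≠ v := by rintro rfl; exact hv hu
  have hpow : 1 ≤ d ^ (2 * s) := Nat.one_le_pow _ _ (by omega)
  set E := ((regularDigraphs n d).filter fun G => G.Adj v u).card with hE
  have hE1 : (n - 1) * E = d * (regularDigraphs n d).card := card_adj huv
  -- `y` is reached too early
  have b1 : 8 * ((regularDigraphs n d).filter fun G =>
      G.Adj v u ∧ Reached G v (2 * s - 1) y).card ≤ E := by
    have h := card_adj_reached_le hd hyv huy.symm huv (2 * s - 1)
    have h2 : 2 * d ^ (2 * s - 1) ≤ d ^ (2 * s) := by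
      calc 2 * d ^ (2 * s - 1) ≤ d * d ^ (2 * s - 1) := by gcongr
        _ = d ^ (2 * s - 1 + 1) := by ring
        _ = _ := by congr 1; omega
    refine Nat.le_of_mul_le_mul_left (c := n - 2) ?_ (by omega)
    set b := ((regularDigraphs n d).filter fun G => G.Adj v u ∧ Reached G v (2 * s - 1) y).card
    calc (n - 2) * (8 * b) = 8 * ((n - 2) * b) := by ring
      _ ≤ 8 * (d ^ (2 * s) * E) :=
        Nat.mul_le_mul_left 8 (h.trans (Nat.mul_le_mul_right _ h2))
      _ = (8 * d ^ (2 * s)) * E := by ring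
      _ ≤ (n - 2) * E := by gcongr; omega
  -- `y` hears from a spy
  have b2 : 8 * ((regularDigraphs n d).filter fun G =>
      G.Adj v u ∧ ∃ t ∈ S, G.Adj t y).card ≤ E := by
    have h1 : ((regularDigraphs n d).filter fun G => G.Adj v u ∧ ∃ t ∈ S, G.Adj t y).card ≤
        ∑ t ∈ S, ((regularDigraphs n d).filter fun G => t ≠ y ∧ G.Adj v u ∧ G.Adj t y).card := by
      refine (Finset.card_le_card fun G hG => ?_).trans Finset.card_biUnion_le
      rw [Finset.mem_filter] at hG
      obtain ⟨hG, h1, t, ht, h2⟩ := hG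
      refine Finset.mem_biUnion.2 ⟨t, ht, Finset.mem_filter.2 ⟨hG, ?_, h1, h2⟩⟩
      rintro rfl
      exact (mem_regularDigraphs.1 hG).loopless _ h2
    refine Nat.le_of_mul_le_mul_left (c := n - 3) ?_ (by omega)
    calc _ ≤ (n - 3) * (8 * ∑ t ∈ S,
          ((regularDigraphs n d).filter fun G => t ≠ y ∧ G.Adj v u ∧ G.Adj t y).card) := by
          gcongr
      _ = 8 * ∑ t ∈ S, (n - 3) *
          ((regularDigraphs n d).filter fun G => t ≠ y ∧ G.Adj v u ∧ G.Adj t y).card := by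
          rw [← Finset.mul_sum]; ring
      _ ≤ 8 * ∑ t ∈ S, d * E := by
          refine Nat.mul_le_mul_left 8 (Finset.sum_le_sum fun t ht => ?_)
          by_cases hty : t = y
          · simp [hty]
          · simpa [hty] using card_adj_adj_le (d := d) hyv huy.symm (Ne.symm hty)
      _ = (8 * d * S.card) * E := by rw [Finset.sum_const, smul_eq_mul]; ring
      _ ≤ (n - 3) * E := by
          gcongr
          have h2 : 1 ≤ S.card := Finset.card_pos.2 ⟨y, hy⟩
          have h3 : 16 * d * 1 ≤ 16 * d * S.card := by gcongr
          have h4 : 16 * d * S.card = 2 * (8 * d * S.card) := by ring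
          omega
  -- some node close to `v` does not reach `y` in time
  have b3 : 8 * ((regularDigraphs n d).filter fun G =>
      G.Adj v u ∧ FarAncestor G 30 (2 * s + 29) v y).card ≤ E := by
    have h1 : ∀ w, ((regularDigraphs n d).filter fun G => ¬ Reached G w (2 * s + 29) y).card ≤
        (regularDigraphs n d).card / (32 * d ^ 30) := fun w => by
      rw [Nat.le_div_iff_mul_le (by positivity), mul_comm]
      exact card_not_reached_mul_le hd hs hn hn' w y
    have h2 := card_adj_farAncestor_le hd hyv huy.symm huv 30 (2 * s + 29) h1
    have h3 := Nat.mul_div_le (regularDigraphs n d).card (32 * d ^ 30)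
    set N := (regularDigraphs n d).card
    set c := N / (32 * d ^ 30)
    set b := ((regularDigraphs n d).filter fun G =>
      G.Adj v u ∧ FarAncestor G 30 (2 * s + 29) v y).card
    have hn2 : n ≤ 2 * (n - 2) := by omega
    refine Nat.le_of_mul_le_mul_left (c := 2 * ((n - 1) * (n - 2))) ?_
      (by have : 0 < n - 2 := by omega
          have : 0 < n - 1 := by omega
          positivity)
    calc 2 * ((n - 1) * (n - 2)) * (8 * b) = 16 * ((n - 1) * ((n - 2) * b)) := by ring
      _ ≤ 16 * (d * (2 * d ^ 30 * (n * c))) := by gcongr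
      _ = d * n * (32 * d ^ 30 * c) := by ring
      _ ≤ d * n * N := by gcongr
      _ = n * ((n - 1) * E) := by rw [hE1]; ring
      _ ≤ 2 * (n - 2) * ((n - 1) * E) := by gcongr
      _ = _ := by ring
  have hsplit : E ≤ ((regularDigraphs n d).filter fun G => G.Adj v u ∧ Typical G S y v s).card +
      ((regularDigraphs n d).filter fun G => G.Adj v u ∧ Reached G v (2 * s - 1) y).card +
      ((regularDigraphs n d).filter fun G => G.Adj v u ∧ ∃ t ∈ S, G.Adj t y).card +
      ((regularDigraphs n d).filter fun G =>
        G.Adj v u ∧ FarAncestor G 30 (2 * s + 29) v y).card := by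
    refine le_trans (Finset.card_le_card ?_) ((Finset.card_union_le _ _).trans
      (add_le_add_left ((Finset.card_union_le _ _).trans
        (add_le_add_left (Finset.card_union_le _ _) _)) _))
    intro G hG
    rw [Finset.mem_filter] at hG
    simp only [Finset.mem_union, Finset.mem_filter, hG.1, hG.2, true_and]
    by_cases h1 : Reached G v (2 * s - 1) y
    · exact Or.inl (Or.inl (Or.inr h1))
    by_cases h2 : ∃ t ∈ S, G.Adj t y
    · exact Or.inl (Or.inr h2)
    by_cases h3 : FarAncestor G 30 (2 * s + 29) v y
    · exact Or.inr h3
    exact Or.inl (Or.inl (Or.inl ⟨h1, fun t ht h => h2 ⟨t, ht, h⟩, h3⟩))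
  omega

theorem card_exposed_typical (hd : 2 ≤ d) {s : ℕ} (hs : 60 ≤ s) (hn : 16 * d ^ (2 * s) ≤ n)
    (hn' : n ≤ 16 * d ^ (2 * s + 2)) {S : Finset (Fin n)} {y v : Fin n} (hy : y ∈ S)
    (hv : v ∉ S) (hS : 16 * d * S.card ≤ n) :
    (S.card - 1) * (regularDigraphs n d).card ≤
      2 * (n - 1) *
        ((regularDigraphs n d).filter fun G => Exposed G S y v ∧ Typical G S y v s).card := by
  have h := mul_card_le_of_adj (d := d) (v := v) hy (T := fun G => Typical G S y v s)
    (c := d * (regularDigraphs n d).card) (m := 2 * (n - 1)) fun u hu huy => by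
      have h1 := card_adj_le_typical hd hs hn hn' hy hv hu huy hS
      rw [← card_adj (d := d) (v := v) (u := u) (by rintro rfl; exact hv hu), mul_assoc,
        mul_left_comm]
      gcongr
  refine Nat.le_of_mul_le_mul_left (c := d) ?_ (by omega)
  calc _ = (S.card - 1) * (d * (regularDigraphs n d).card) := by ring
    _ ≤ _ := h
    _ = _ := by ring

end

/-! ### Precision, its expectation, and the blind guess -/

section

variable {n d a m : ℕ} {G : Digraph (Fin n)} {S : Finset (Fin n)}

/-! ### Precision -/

theorem precisionAt_nonneg (X : GroundTruth S m) (f : Fin m → Fin n) (v : {v : Fin n // v ∉ S}) :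
    0 ≤ precisionAt X f v := by
  unfold precisionAt
  split_ifs <;> positivity

theorem precisionAt_le_one (X : GroundTruth S m) (f : Fin m → Fin n) (v : {v : Fin n // v ∉ S}) :
    precisionAt X f v ≤ 1 := by
  unfold precisionAt
  split_ifs with h
  · refine div_le_one_of_le₀ ?_ (by positivity)
    have : 0 < (Finset.univ.filter fun w : {w : Fin n // w ∉ S} => f (X w) = v).card :=
      Finset.card_pos.2 ⟨v, by simpa using h⟩
    exact_mod_cast this
  · simp

theorem card_honest (X : GroundTruth S m) : Fintype.card {v : Fin n // v ∉ S} = m := by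
  rw [Fintype.card_congr X, Fintype.card_fin]

theorem precision_le_one (X : GroundTruth S m) (f : Fin m → Fin n) : precision X f ≤ 1 := by
  refine div_le_one_of_le₀ ?_ (by positivity)
  calc _ ≤ ∑ _v : {v : Fin n // v ∉ S}, (1 : ℝ) :=
        Finset.sum_le_sum fun v _ => precisionAt_le_one X f v
    _ = m := by
        rw [Finset.sum_const, Finset.card_univ, card_honest X, nsmul_eq_mul, mul_one]

theorem inv_le_precisionAt {X : GroundTruth S m} {f : Fin m → Fin n} {v : {v : Fin n // v ∉ S}}
    (h : f (X v) = v) {K : ℕ} (hK : ∀ w, f (X w) = v → (w : Fin n) ∈ (T : Finset (Fin n)))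
    (hT : T.card ≤ K) : (1 : ℝ) / K ≤ precisionAt X f v := by
  unfold precisionAt
  rw [if_pos h]
  have h0 : 0 < (Finset.univ.filter fun w : {w : Fin n // w ∉ S} => f (X w) = v).card :=
      Finset.card_pos.2 ⟨v, by simpa using h⟩
  have h1 : (Finset.univ.filter fun w : {w : Fin n // w ∉ S} => f (X w) = v).card ≤ K := by
    refine le_trans (Finset.card_le_card_of_injOn Subtype.val ?_ ?_) hT
    · intro w hw
      simp only [Finset.coe_filter, Finset.mem_univ, true_and, Set.mem_ofPred_eq] at hw
      exact hK w hw
    · exact Subtype.val_injective.injOn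
  refine one_div_le_one_div_of_le (by exact_mod_cast h0) (by exact_mod_cast h1)

/-- A lower bound for the precision that only involves the number of correctly mapped messages. -/
theorem le_precision (X : GroundTruth S m) (hm : 0 < m) (f : Fin m → Fin n) {β : ℝ} :
    (∑ v : {v : Fin n // v ∉ S}, if f (X v) = v then 2 * β else 0) / m - β ^ 2 ≤
      precision X f := by
  have hm' : (0 : ℝ) < m := by exact_mod_cast hm
  have h1 : ∀ v : {v : Fin n // v ∉ S}, (if f (X v) = v then 2 * β else 0) -
      β ^ 2 * ((Finset.univ.filter fun w : {w : Fin n // w ∉ S} => f (X w) = v).card : ℝ) ≤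
      precisionAt X f v := by
    intro v
    unfold precisionAt
    split_ifs with h
    · have h0 : 0 < (Finset.univ.filter fun w : {w : Fin n // w ∉ S} => f (X w) = v).card :=
        Finset.card_pos.2 ⟨v, by simpa using h⟩
      have h0' : (0 : ℝ) <
        (Finset.univ.filter fun w : {w : Fin n // w ∉ S} => f (X w) = v).card := by
        exact_mod_cast h0
      rw [le_div_iff₀ h0']
      -- With $k$ messages mapped to $v$, this is $1/k\ge 2\beta-\beta^2k$. It makes the
      -- denominators additive, and they sum to at most $m$.
      nlinarith [sq_nonneg (1 - β *
        ((Finset.univ.filter fun w : {w : Fin n // w ∉ S} => f (X w) = v).card : ℝ))]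
    · have : 0 ≤ β ^ 2 *
        ((Finset.univ.filter fun w : {w : Fin n // w ∉ S} => f (X w) = v).card : ℝ) := by
        positivity
      simp only [zero_div]
      linarith
  have h2 : (∑ v : {v : Fin n // v ∉ S},
      ((Finset.univ.filter fun w : {w : Fin n // w ∉ S} => f (X w) = v).card : ℝ)) ≤ m := by
    exact_mod_cast calc
      ∑ v : {v : Fin n // v ∉ S},
        (Finset.univ.filter fun w : {w : Fin n // w ∉ S} => f (X w) = v).card
        = ((Finset.univ : Finset {v : Fin n // v ∉ S}).biUnion fun v =>
            Finset.univ.filter fun w : {w : Fin n // w ∉ S} => f (X w) = v).card := by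
          refine (Finset.card_biUnion fun v _ v' _ hvv => ?_).symm
          refine Finset.disjoint_left.2 fun w hw hw' => ?_
          simp only [Finset.mem_filter, Finset.mem_univ, true_and] at hw hw'
          exact hvv (Subtype.ext (hw.symm.trans hw'))
      _ ≤ Fintype.card {v : Fin n // v ∉ S} := Finset.card_le_univ _
      _ = m := card_honest X
  have h3 := Finset.sum_le_sum fun v (_ : v ∈ Finset.univ) => h1 v
  rw [Finset.sum_sub_distrib, ← Finset.mul_sum] at h3
  unfold precision
  rw [div_sub' hm'.ne', div_le_div_iff_of_pos_right hm']
  nlinarith [mul_le_mul_of_nonneg_left h2 (sq_nonneg β)]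

/-! ### Expected precision -/

theorem nonempty_groundTruth (h : S.card = a) : Nonempty (GroundTruth S (n - a)) := by
  refine ⟨Fintype.equivFinOfCardEq ?_⟩
  rw [Fintype.card_subtype_compl, Fintype.card_fin]
  simp [h]

theorem powersetCard_nonempty (ha : a < n) :
    (Finset.powersetCard a (Finset.univ : Finset (Fin n))).Nonempty :=
  Finset.powersetCard_nonempty.2 (by simpa using ha.le)

theorem expectedPrecision_le_one (hG : (regularDigraphs n d).Nonempty) (ha : a < n)
    (M : Strategy n d a) : expectedPrecision n d a M ≤ 1 := by
  refine Finset.expect_le hG fun G _ => Finset.expect_le (powersetCard_nonempty ha) fun S hS => ?_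
  have := nonempty_groundTruth (n := n) (Finset.mem_powersetCard.1 hS).2
  exact Finset.expect_le Finset.univ_nonempty fun X _ => precision_le_one _ _

theorem expectedPrecision_le_optimalPrecision (hG : (regularDigraphs n d).Nonempty) (ha : a < n)
    (M : Strategy n d a) : expectedPrecision n d a M ≤ optimalPrecision n d a :=
  le_ciSup (f := fun M : Strategy n d a => expectedPrecision n d a M)
    ⟨1, by rintro _ ⟨M, rfl⟩; exact expectedPrecision_le_one hG ha M⟩ M

/-- It suffices to bound the precision on average over the network, for fixed spies and fixed
ground truth. -/
theorem le_expectedPrecision (hG : (regularDigraphs n d).Nonempty) (ha : a < n)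
    (M : Strategy n d a) {δ : ℝ} (h : ∀ (S : Finset (Fin n)), S.card = a →
      ∀ X : GroundTruth S (n - a), δ * (regularDigraphs n d).card ≤
        ∑ G ∈ regularDigraphs n d, precision X (M.1 (observe G S X))) :
    δ ≤ expectedPrecision n d a M := by
  unfold expectedPrecision
  rw [Finset.expect_comm]
  refine Finset.le_expect (powersetCard_nonempty ha) fun S hS => ?_
  have hS' := (Finset.mem_powersetCard.1 hS).2
  have := nonempty_groundTruth (n := n) hS'
  rw [Finset.expect_comm]
  refine Finset.le_expect Finset.univ_nonempty fun X _ => ?_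
  rw [Finset.expect_eq_sum_div_card, le_div_iff₀ (by exact_mod_cast hG.card_pos)]
  exact h S hS' X

/-! ### Blind guessing -/

/-- Composing with a transposition of messages permutes the ground truths, so all messages are
equally likely at $v$, and their probabilities add up to 1. -/
theorem expect_groundTruth_eq [Nonempty (GroundTruth S m)] (v : {v : Fin n // v ∉ S}) (j : Fin m) :
    (𝔼 X : GroundTruth S m, if X v = j then (1 : ℝ) else 0) = 1 / m := by
  have h1 : ∀ j', (𝔼 X : GroundTruth S m, if X v = j' then (1 : ℝ) else 0) =
      𝔼 X : GroundTruth S m, if X v = j then (1 : ℝ) else 0 := by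
    intro j'
    refine Fintype.expect_equiv ⟨fun X => X.trans (Equiv.swap j' j),
      fun X => X.trans (Equiv.swap j' j), fun X => ?_, fun X => ?_⟩ _ _ fun X => ?_
    · ext; simp
    · ext; simp
    · have : X v = j' ↔ (Equiv.swap j' j) (X v) = j := by
        rw [Equiv.swap_apply_eq_iff, Equiv.swap_apply_right]
      exact if_congr this rfl rfl
  have h2 : ∑ j' : Fin m, (𝔼 X : GroundTruth S m, if X v = j' then (1 : ℝ) else 0) = 1 := by
    rw [← Finset.expect_sum_comm]
    simp
  rw [Finset.sum_congr rfl fun j' _ => h1 j', Finset.sum_const, Finset.card_univ,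
    Fintype.card_fin, nsmul_eq_mul] at h2
  have hm : (m : ℝ) ≠ 0 := by rintro h0; rw [h0, zero_mul] at h2; exact zero_ne_one h2
  rw [eq_div_iff hm, mul_comm]
  exact h2

theorem precision_enumeration (X e : GroundTruth S m) :
    precision X (fun x => (e.symm x : Fin n)) =
      (∑ v : {v : Fin n // v ∉ S}, if X v = e v then (1 : ℝ) else 0) / m := by
  unfold precision precisionAt
  congr 1
  refine Finset.sum_congr rfl fun v _ => ?_
  have h1 : ∀ w : {v : Fin n // v ∉ S}, ((e.symm (X w) : Fin n) = v) ↔ X w = e v := fun w => by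
    rw [Subtype.coe_inj, Equiv.symm_apply_eq]
  have h2 : (Finset.univ.filter fun w : {w : Fin n // w ∉ S} =>
      (e.symm (X w) : Fin n) = v).card = 1 := by
    rw [Finset.card_eq_one]
    refine ⟨X.symm (e v), ?_⟩
    ext w
    simp only [Finset.mem_filter, Finset.mem_univ, true_and, Finset.mem_singleton, h1]
    rw [Equiv.eq_symm_apply]
  rw [h2]
  simp [h1]

/-- The strategy that ignores the logs and maps the messages to the honest nodes in a fixed
one-to-one way. -/
def blindStrategy (n d a : ℕ) (hn : 0 < n) : Strategy n d a :=
  ⟨fun O x => if h : O.spies.card = a then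
      (((nonempty_groundTruth h).some.symm x : {v : Fin n // v ∉ O.spies}) : Fin n)
    else ⟨0, hn⟩, by
    intro G _ S hS X x
    have hS' : S.card = a := (Finset.mem_powersetCard.1 hS).2
    dsimp only [observe]
    split_ifs
    exact ((nonempty_groundTruth hS').some.symm x).2⟩

theorem expectedPrecision_blindStrategy (hG : (regularDigraphs n d).Nonempty) (ha : a < n) :
    expectedPrecision n d a (blindStrategy n d a (by omega)) = 1 / ((n - a : ℕ) : ℝ) := by
  unfold expectedPrecision
  rw [← Finset.expect_const hG (1 / ((n - a : ℕ) : ℝ))]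
  refine Finset.expect_congr rfl fun G _ => ?_
  rw [← Finset.expect_const (powersetCard_nonempty ha) (1 / ((n - a : ℕ) : ℝ))]
  refine Finset.expect_congr rfl fun S hS => ?_
  have hS' : S.card = a := (Finset.mem_powersetCard.1 hS).2
  have hne := nonempty_groundTruth (n := n) hS'
  have h1 : ∀ X : GroundTruth S (n - a),
      precision X ((blindStrategy n d a (by omega)).1 (observe G S X)) =
      (∑ v : {v : Fin n // v ∉ S},
        if X v = hne.some v then (1 : ℝ) else 0) / ((n - a : ℕ) : ℝ) := by
    intro X
    rw [← precision_enumeration]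
    congr 1
    funext x
    simp only [blindStrategy, observe, dif_pos hS']
  rw [Finset.expect_congr rfl fun X _ => h1 X, ← Finset.expect_div, Finset.expect_sum_comm,
    Finset.sum_congr rfl fun v _ => expect_groundTruth_eq v _, Finset.sum_const,
    Finset.card_univ, card_honest hne.some, nsmul_eq_mul]
  have : ((n - a : ℕ) : ℝ) ≠ 0 := by
    have : 0 < n - a := by omega
    positivity
  field_simp

end

/-! ### The clocked first-spy strategy and its precision -/

section

variable {n d a m : ℕ} {G : Digraph (Fin n)} {S : Finset (Fin n)}

/-- There is a `d`-regular digraph on `n > d` nodes: a circulant. -/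
theorem regularDigraphs_nonempty (h : d < n) : (regularDigraphs n d).Nonempty := by
  have : NeZero n := ⟨by omega⟩
  obtain ⟨D, hD, hcard⟩ : ∃ D ⊆ (Finset.univ.erase (0 : Fin n)), D.card = d :=
    Finset.exists_subset_card_eq (by
      rw [Finset.card_erase_of_mem (Finset.mem_univ _), Finset.card_univ, Fintype.card_fin]
      omega)
  refine ⟨⟨fun u v => v - u ∈ D⟩, mem_regularDigraphs.2 ⟨fun v hv => ?_, fun v => ?_, fun v => ?_⟩⟩
  · have hv' : v - v ∈ D := hv
    rw [sub_self] at hv'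
    exact Finset.notMem_erase _ _ (hD hv')
  · have : {w | w - v ∈ D} = Equiv.addRight v '' (D : Set (Fin n)) := by
      ext w
      rw [Equiv.image_eq_preimage_symm]
      simp [sub_eq_add_neg]
    refine (congrArg Set.ncard this).trans ?_
    rw [Set.ncard_image_of_injective _ (Equiv.addRight v).injective, Set.ncard_coe_finset, hcard]
  · have : {w | v - w ∈ D} = Equiv.subLeft v '' (D : Set (Fin n)) := by
      ext w
      rw [Equiv.image_eq_preimage_symm]
      simp [sub_eq_add_neg, add_comm]
    refine (congrArg Set.ncard this).trans ?_
    rw [Set.ncard_image_of_injective _ (Equiv.subLeft v).injective, Set.ncard_coe_finset, hcard]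

/-! ### The flooding strategy -/

/-- The node `v` is a candidate for the source of `x`: it delivered `x` to the first spy, other
than `y`, and nobody reported a delivery of `x` to `y` too early after this. -/
def Candidate (O : Observation n m) (R : ℕ) (y : Fin n) (x : Fin m) (v : Fin n) : Prop :=
  (∃ u ∈ O.spies, u ≠ y ∧ (x, u, 0) ∈ O.log v) ∧ ∀ h r, (x, y, r) ∈ O.log h → R ≤ r + 1

/-- The strategy that maps a message to some candidate. -/
def floodStrategy (n d a R : ℕ) (y v₀ : Finset (Fin n) → Fin n)
    (h₀ : ∀ S : Finset (Fin n), S.card = a → v₀ S ∉ S) : Strategy n d a :=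
  ⟨fun O x => if h : ∃ v, Candidate O R (y O.spies) x v then h.choose else v₀ O.spies, by
    intro G _ S hS X x
    dsimp only
    split_ifs with h
    · obtain ⟨u, -, -, hu⟩ := h.choose_spec.1
      exact hu.1
    · exact h₀ S (Finset.mem_powersetCard.1 hS).2⟩

theorem mem_log {X : GroundTruth S m} {v u : Fin n} {x : Fin m} {r : ℕ} :
    (x, u, r) ∈ (observe G S X).log v ↔ v ∉ S ∧ u ∈ S ∧ G.Adj v u ∧
      ∃ t t₀ : ℕ, ReceivedAt G (X.symm x) v t ∧ ReceivedAt G (X.symm x) u (t + 1) ∧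
        FirstSpyTime G S (X.symm x) t₀ ∧ t + 1 = t₀ + r := Iff.rfl

theorem FirstSpyTime.unique {s : Fin n} {t t' : ℕ} (h : FirstSpyTime G S s t)
    (h' : FirstSpyTime G S s t') : t = t' := by
  obtain ⟨⟨u, hu, hut⟩, h2⟩ := h
  obtain ⟨⟨u', hu', hut'⟩, h2'⟩ := h'
  exact le_antisymm (h2 u' hu' _ hut') (h2' u hu _ hut)

theorem receivedAt_one {v u : Fin n} (h : G.Adj v u) (hne : u ≠ v) : ReceivedAt G v u 1 := by
  refine ⟨Reached.step (t := 0) rfl h, fun t ht h0 => ?_⟩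
  have : t = 0 := by omega
  subst this
  exact hne h0

theorem firstSpyTime_one {v u : Fin n} (hv : v ∉ S) (hu : u ∈ S) (h : G.Adj v u) :
    FirstSpyTime G S v 1 := by
  refine ⟨⟨u, hu, receivedAt_one h (by rintro rfl; exact hv hu)⟩, fun u' hu' t ht => ?_⟩
  rcases Nat.eq_zero_or_pos t with rfl | ht'
  · rw [receivedAt_zero] at ht
    subst ht
    exact absurd hu' hv
  · exact ht'

/-- For an exposed source the first spy is reached in round 1, so whoever delivered to it had the
message in round 0. Timestamps count from round 1, so $r+1$ is the true arrival round at $y$ and the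
clock test compares it with $R$. -/
theorem candidate_iff_of_exposed {X : GroundTruth S m} {R : ℕ} {y : Fin n}
    {v : {v : Fin n // v ∉ S}} (hE : Exposed G S y v) (hR : ∀ t, Reached G v t y → R ≤ t)
    (v' : Fin n) : Candidate (observe G S X) R y (X v) v' ↔ v' = v := by
  obtain ⟨u, hu, huy, hvu⟩ := hE
  have hfirst : FirstSpyTime G S v 1 := firstSpyTime_one v.2 hu hvu
  constructor
  · rintro ⟨⟨u', -, -, hlog⟩, -⟩
    rw [mem_log, Equiv.symm_apply_apply] at hlog
    obtain ⟨-, -, -, t, t₀, h1, -, h3, h4⟩ := hlog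
    have := h3.unique hfirst
    have ht : t = 0 := by omega
    subst ht
    exact receivedAt_zero.1 h1
  · rintro rfl
    refine ⟨⟨u, hu, huy, ?_⟩, fun h r hlog => ?_⟩
    · rw [mem_log, Equiv.symm_apply_apply]
      exact ⟨v.2, hu, hvu, 0, 1, receivedAt_zero.2 rfl,
        receivedAt_one hvu (by rintro rfl; exact v.2 hu), hfirst, rfl⟩
    · rw [mem_log, Equiv.symm_apply_apply] at hlog
      obtain ⟨-, -, -, t, t₀, -, h2, h3, h4⟩ := hlog
      have := h3.unique hfirst
      have := hR _ h2.1
      omega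

/-- A candidate is close to the source. -/
theorem Candidate.reached {X : GroundTruth S m} {R k l : ℕ} {y v : Fin n} {x : Fin m}
    (h : Candidate (observe G S X) R y x v) (hy : y ∈ S) (hS : ∀ t ∈ S, ¬ G.Adj t y)
    (hl : l < R + k) (hfar : ¬ FarAncestor G k l v y) : Reached G (X.symm x) k v := by
  obtain ⟨⟨u, hu, huy, hlog⟩, hR⟩ := h
  rw [mem_log] at hlog
  obtain ⟨-, -, -, t, t₀, h1, h2, h3, h4⟩ := hlog
  by_contra hk
  have htk : k < t := not_le.1 fun htk => hk (h1.1.mono htk)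
  have h1' := h1.1
  -- Follow the message back $k$ rounds to a node $w$; its short route to $y$ gives an arrival at
  -- $y$ by round $t-k+l<t+R$.
  rw [show t = (t - k) + k by omega] at h1'
  obtain ⟨w, hw1, hw2⟩ := h1'.split
  have hw3 : Reached G w l y := by
    by_contra hw3
    exact hfar ⟨w, hw2, hw3⟩
  obtain ⟨D, hD, hyD⟩ := (hw1.trans hw3).exists_receivedAt
  have hD' := h3.2 y hy D hyD
  obtain ⟨D, rfl⟩ : ∃ D', D = D' + 1 := ⟨D - 1, by omega⟩
  obtain ⟨z, hz, hzy⟩ := hyD.exists_pred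
  -- The early arrival is visible to the adversary only because the node delivering to $y$ is
  -- honest.
  have hlog' : (x, y, D - t) ∈ (observe G S X).log z := by
    rw [mem_log]
    exact ⟨fun hzS => hS z hzS hzy, hy, hzy, D, t₀, hz, hyD, h3, by omega⟩
  have := hR _ _ hlog'
  omega

section Strategy

variable {R : ℕ} {y v₀ : Finset (Fin n) → Fin n}
  {h₀ : ∀ S : Finset (Fin n), S.card = a → v₀ S ∉ S} {X : GroundTruth S (n - a)}

theorem floodStrategy_of_exposed {v : {v : Fin n // v ∉ S}} (hE : Exposed G S (y S) v)
    (hR : ∀ t, Reached G v t (y S) → R ≤ t) :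
    (floodStrategy n d a R y v₀ h₀).1 (observe G S X) (X v) = v := by
  have h := candidate_iff_of_exposed (X := X) hE hR
  have hex : ∃ v', Candidate (observe G S X) R (y S) (X v) v' := ⟨v, (h v).2 rfl⟩
  have : (floodStrategy n d a R y v₀ h₀).1 (observe G S X) (X v) = hex.choose := dif_pos hex
  rw [this]
  exact (h _).1 hex.choose_spec

theorem candidate_of_floodStrategy {x : Fin (n - a)} {v : Fin n}
    (h : (floodStrategy n d a R y v₀ h₀).1 (observe G S X) x = v) (hv : v ≠ v₀ S) :
    Candidate (observe G S X) R (y S) x v := by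
  by_cases hex : ∃ v', Candidate (observe G S X) R (y S) x v'
  · have : (floodStrategy n d a R y v₀ h₀).1 (observe G S X) x = hex.choose := dif_pos hex
    rw [← h, this]
    exact hex.choose_spec
  · have : (floodStrategy n d a R y v₀ h₀).1 (observe G S X) x = v₀ S := dif_neg hex
    exact absurd (h.symm.trans this) hv

/-- Lateness of $y$ lets $v$ pass the clock for its own message; the other two conditions confine
all sources mapped to $v$ to its backward ball of radius 30. -/
theorem le_precisionAt_floodStrategy (hd : 2 ≤ d) (hG : IsRegular G d) {s : ℕ} (hs : 1 ≤ s)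
    {v : {v : Fin n // v ∉ S}} (hy : y S ∈ S) (hv : (v : Fin n) ≠ v₀ S)
    (hE : Exposed G S (y S) v) (hT : Typical G S (y S) v s) :
    1 / (2 * (d : ℝ) ^ 30) ≤
      precisionAt X ((floodStrategy n d a (2 * s) y v₀ h₀).1 (observe G S X)) v := by
  have h1 : (floodStrategy n d a (2 * s) y v₀ h₀).1 (observe G S X) (X v) = v := by
    refine floodStrategy_of_exposed hE fun t ht => ?_
    by_contra hlt
    exact hT.late (ht.mono (by omega))
  have h2 := inv_le_precisionAt (T := ball (rev G) v 30) (K := 2 * d ^ 30) h1 (fun w hw => ?_)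
    (card_ball_le hd hG.rev _ _)
  · exact_mod_cast h2
  · have := (candidate_of_floodStrategy hw hv).reached hy hT.honest (k := 30) (l := 2 * s + 29)
      (by omega) hT.near
    rw [Equiv.symm_apply_apply] at this
    rw [mem_ball, reached_rev]
    exact this

end Strategy

theorem exists_spy_and_default (n a : ℕ) (ha : 1 ≤ a) (han : a < n) :
    ∃ y v₀ : Finset (Fin n) → Fin n,
      (∀ S : Finset (Fin n), S.card = a → y S ∈ S) ∧
      ∀ S : Finset (Fin n), S.card = a → v₀ S ∉ S := by
  have h1 : ∀ S : Finset (Fin n), ∃ y, S.card = a → y ∈ S := fun S => by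
    by_cases hS : S.card = a
    · obtain ⟨y, hy⟩ := Finset.card_pos.1 (by omega : 0 < S.card)
      exact ⟨y, fun _ => hy⟩
    · exact ⟨⟨0, by omega⟩, fun h => absurd h hS⟩
  have h2 : ∀ S : Finset (Fin n), ∃ y, S.card = a → y ∉ S := fun S => by
    by_cases hS : S.card = a
    · obtain ⟨y, hy⟩ : ∃ y, y ∉ S := by
        by_contra! hall
        have := Finset.card_le_card (fun x _ => hall x : Finset.univ ⊆ S)
        rw [Finset.card_univ, Fintype.card_fin] at this
        omega
      exact ⟨y, fun _ => hy⟩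
    · exact ⟨⟨0, by omega⟩, fun h => absurd h hS⟩
  choose y hy using h1
  choose v₀ hv₀ using h2
  exact ⟨y, v₀, hy, hv₀⟩

/-- If there are many spies, already the first-spy estimator is precise. -/
theorem sq_le_optimalPrecision (hd : 2 ≤ d) (hdn : d < n) (ha : 2 ≤ a) (han : a < n) :
    ((a : ℝ) / n / 2) ^ 2 ≤ optimalPrecision n d a := by
  have hG := regularDigraphs_nonempty hdn
  obtain ⟨y, v₀, hy, hv₀⟩ := exists_spy_and_default n a (by omega) han
  -- Threshold 0 makes the clock test vacuous and leaves the first-spy estimator.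
  refine le_trans ?_ (expectedPrecision_le_optimalPrecision hG han
    (floodStrategy n d a 0 y v₀ hv₀))
  refine le_expectedPrecision hG han _ fun S hS X => ?_
  set f := fun G => (floodStrategy n d a 0 y v₀ hv₀).1 (observe G S X) with hf
  set β : ℝ := (a : ℝ) / n / 2 with hβ
  have hn0 : (0 : ℝ) < n := by exact_mod_cast (by omega : 0 < n)
  have hβ0 : 0 ≤ β := by positivity
  have hm : 0 < n - a := by omega
  have hm' : (0 : ℝ) < ((n - a : ℕ) : ℝ) := by exact_mod_cast hm
  have hcount : ∀ v : {v : Fin n // v ∉ S}, β * (regularDigraphs n d).card ≤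
      ((regularDigraphs n d).filter fun G => f G (X v) = v).card := by
    intro v
    have h1 := card_exposed hd (hy S hS) v.2
    have h2 : ((regularDigraphs n d).filter fun G => Exposed G S (y S) v).card ≤
        ((regularDigraphs n d).filter fun G => f G (X v) = v).card := by
      refine Finset.card_le_card fun G hG => ?_
      rw [Finset.mem_filter] at hG ⊢
      exact ⟨hG.1, floodStrategy_of_exposed hG.2 fun t _ => Nat.zero_le t⟩
    rw [hS] at h1
    have h3 : a * (regularDigraphs n d).card ≤
        2 * (n * ((regularDigraphs n d).filter fun G => f G (X v) = v).card) := by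
      calc _ ≤ 2 * (a - 1) * (regularDigraphs n d).card := by gcongr; omega
        _ = 2 * ((a - 1) * (regularDigraphs n d).card) := by ring
        _ ≤ 2 * ((n - 1) * ((regularDigraphs n d).filter fun G => Exposed G S (y S) v).card) := by
            gcongr
        _ ≤ _ := by gcongr; omega
    have h4 : (a : ℝ) * (regularDigraphs n d).card ≤
        2 * (n * ((regularDigraphs n d).filter fun G => f G (X v) = v).card) := by
      exact_mod_cast h3
    rw [hβ, div_div, div_mul_eq_mul_div, div_le_iff₀ (by positivity)]
    linarith
  set N : ℝ := ((regularDigraphs n d).card : ℝ)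
  calc β ^ 2 * N = (∑ v : {v : Fin n // v ∉ S}, 2 * β * (β * N)) / ((n - a : ℕ) : ℝ)
        - β ^ 2 * N := by
        rw [Finset.sum_const, Finset.card_univ, card_honest X, nsmul_eq_mul]
        field_simp
        ring
    _ ≤ (∑ v : {v : Fin n // v ∉ S}, 2 * β *
        ((regularDigraphs n d).filter fun G => f G (X v) = v).card) / ((n - a : ℕ) : ℝ)
        - β ^ 2 * N := by
        gcongr with v
        exact hcount v
    _ = ∑ G ∈ regularDigraphs n d, ((∑ v : {v : Fin n // v ∉ S},
        if f G (X v) = v then 2 * β else 0) / ((n - a : ℕ) : ℝ) - β ^ 2) := by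
        rw [Finset.sum_sub_distrib, ← Finset.sum_div, Finset.sum_comm, Finset.sum_const,
          nsmul_eq_mul, mul_comm (β ^ 2)]
        congr 2
        refine Finset.sum_congr rfl fun v _ => ?_
        rw [← Finset.sum_filter, Finset.sum_const, nsmul_eq_mul, mul_comm]
    _ ≤ _ := Finset.sum_le_sum fun G _ => le_precision X hm (f G)

/-- If there are few spies, the arrival time at one further spy makes flooding traceable. -/
theorem mul_le_optimalPrecision (hd : 2 ≤ d) {s : ℕ} (hs : 60 ≤ s) (hn : 16 * d ^ (2 * s) ≤ n)
    (hn' : n ≤ 16 * d ^ (2 * s + 2)) (hdn : d < n) (ha : 2 ≤ a) (han : 16 * d * a ≤ n) :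
    1 / (16 * (d : ℝ) ^ 30) * (a / n) ≤ optimalPrecision n d a := by
  have hG := regularDigraphs_nonempty hdn
  have han2 : a + 2 ≤ n := by
    have : 16 * 2 * a ≤ 16 * d * a := by gcongr
    omega
  obtain ⟨y, v₀, hy, hv₀⟩ := exists_spy_and_default n a (by omega) (by omega)
  refine le_trans ?_ (expectedPrecision_le_optimalPrecision hG (by omega)
    (floodStrategy n d a (2 * s) y v₀ hv₀))
  refine le_expectedPrecision hG (by omega) _ fun S hS X => ?_
  set f := fun G => (floodStrategy n d a (2 * s) y v₀ hv₀).1 (observe G S X) with hf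
  have hn0 : (0 : ℝ) < n := by exact_mod_cast (by omega : 0 < n)
  have hd0 : (0 : ℝ) < d := by exact_mod_cast (by omega : 0 < d)
  have hm : 2 ≤ n - a := by omega
  have hm' : (2 : ℝ) ≤ ((n - a : ℕ) : ℝ) := by exact_mod_cast hm
  set N : ℝ := ((regularDigraphs n d).card : ℝ) with hN
  have hcount : ∀ v : {v : Fin n // v ∉ S}, (a : ℝ) / n / 4 * N ≤
      ((regularDigraphs n d).filter fun G =>
        Exposed G S (y S) v ∧ Typical G S (y S) v s).card := by
    intro v
    have h1 := card_exposed_typical hd hs hn hn' (hy S hS) v.2 (by rwa [hS])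
    rw [hS] at h1
    set b := ((regularDigraphs n d).filter fun G =>
        Exposed G S (y S) v ∧ Typical G S (y S) v s).card
    have h3 : a * (regularDigraphs n d).card ≤ 4 * (n * b) := by
      calc _ ≤ 2 * (a - 1) * (regularDigraphs n d).card := by gcongr; omega
        _ = 2 * ((a - 1) * (regularDigraphs n d).card) := by ring
        _ ≤ 2 * (2 * (n - 1) * b) := by gcongr
        _ ≤ 2 * (2 * n * b) := by gcongr; omega
        _ = _ := by ring
    have h4 : (a : ℝ) * N ≤ 4 * (n * (b : ℝ)) := by
      rw [hN]
      exact_mod_cast h3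
    rw [div_div, div_mul_eq_mul_div, div_le_iff₀ (by positivity)]
    linarith
  -- The default node collects all messages without a candidate, so it is dropped from the sum. As
  -- $n-a\ge 2$, this costs at most a factor 2.
  set w₀ : {v : Fin n // v ∉ S} := ⟨v₀ S, hv₀ S hS⟩
  calc 1 / (16 * (d : ℝ) ^ 30) * (a / n) * N
      = ((n - a : ℕ) : ℝ) / 2 * (a / n / 4 * N * (1 / (2 * (d : ℝ) ^ 30))) /
        ((n - a : ℕ) : ℝ) := by
        field_simp
        ring
    _ ≤ (((n - a : ℕ) : ℝ) - 1) * (a / n / 4 * N * (1 / (2 * (d : ℝ) ^ 30))) /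
        ((n - a : ℕ) : ℝ) := by
        gcongr
        linarith
    _ = (∑ v ∈ Finset.univ.erase w₀, a / n / 4 * N * (1 / (2 * (d : ℝ) ^ 30))) /
        ((n - a : ℕ) : ℝ) := by
        rw [Finset.sum_const, Finset.card_erase_of_mem (Finset.mem_univ _), Finset.card_univ,
          card_honest X, nsmul_eq_mul, Nat.cast_sub (by omega : 1 ≤ n - a), Nat.cast_one]
    _ ≤ (∑ v ∈ Finset.univ.erase w₀, ((regularDigraphs n d).filter fun G =>
        Exposed G S (y S) v ∧ Typical G S (y S) v s).card * (1 / (2 * (d : ℝ) ^ 30))) /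
        ((n - a : ℕ) : ℝ) := by
        gcongr with v
        exact hcount v
    _ ≤ (∑ v ∈ Finset.univ.erase w₀, ∑ G ∈ regularDigraphs n d, precisionAt X (f G) v) /
        ((n - a : ℕ) : ℝ) := by
        gcongr with v hv
        rw [← nsmul_eq_mul, ← Finset.sum_const, Finset.sum_filter]
        refine Finset.sum_le_sum fun G hG => ?_
        split_ifs with h
        · refine le_precisionAt_floodStrategy hd (mem_regularDigraphs.1 hG) (by omega) (hy S hS)
            (fun h => Finset.ne_of_mem_erase hv (Subtype.ext h)) h.1 h.2
        · exact precisionAt_nonneg _ _ _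
    _ ≤ (∑ v, ∑ G ∈ regularDigraphs n d, precisionAt X (f G) v) / ((n - a : ℕ) : ℝ) := by
        gcongr
        · exact fun v _ _ => Finset.sum_nonneg fun G _ => precisionAt_nonneg _ _ _
        · exact Finset.subset_univ _
    _ = _ := by
        rw [Finset.sum_comm, Finset.sum_div]
        rfl

theorem one_div_le_optimalPrecision (hdn : d < n) (han : a < n) :
    1 / (n : ℝ) ≤ optimalPrecision n d a := by
  have hG := regularDigraphs_nonempty hdn
  refine le_trans ?_ (expectedPrecision_le_optimalPrecision hG han
    (blindStrategy n d a (by omega)))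
  rw [expectedPrecision_blindStrategy hG han]
  refine one_div_le_one_div_of_le (by exact_mod_cast (by omega : 0 < n - a)) ?_
  exact_mod_cast Nat.sub_le n a

theorem exists_scale (hd : 2 ≤ d) (hn : 16 * d ^ 120 ≤ n) :
    ∃ s, 60 ≤ s ∧ 16 * d ^ (2 * s) ≤ n ∧ n ≤ 16 * d ^ (2 * s + 2) := by
  have hd2 : 1 < d ^ 2 := Nat.one_lt_pow (by omega) (by omega)
  have h1 : d ^ 120 ≤ n / 16 := by omega
  have hpos : 0 < d ^ 120 := by positivity
  refine ⟨Nat.log (d ^ 2) (n / 16), ?_, ?_, ?_⟩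
  · rw [Nat.le_log_iff_pow_le hd2 (by omega), ← pow_mul]
    exact h1
  · have := Nat.pow_log_le_self (d ^ 2) (x := n / 16) (by omega)
    rw [← pow_mul] at this
    omega
  · have := Nat.lt_pow_succ_log_self hd2 (n / 16)
    rw [← pow_mul, Nat.succ_eq_add_one, mul_add, mul_one] at this
    omega

end

end

end FloodingAnonymity

/-! ### Assembling the ranges of $n$ and $p$ -/

theorem mainTheorem11 (d : ℕ) (hd : 2 ≤ d) :
    ∃ c : ℝ, 0 < c ∧ ∀ (n a : ℕ) (p : ℝ), d < n → a < n → (a : ℝ) = p * n →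
      c * p ≤ FloodingAnonymity.optimalPrecision n d a := by
  have hd1 : (1 : ℝ) ≤ d := by exact_mod_cast (by omega : 1 ≤ d)
  -- The distance estimate needs $s\ge 60$, that is $n\ge 16d^{120}$; below this the blind bound
  -- $1/n$ exceeds the constant.
  refine ⟨1 / (16 * (d : ℝ) ^ 120), by positivity, fun n a p hdn han hp => ?_⟩
  have hn0 : (0 : ℝ) < n := by exact_mod_cast (by omega : 0 < n)
  obtain rfl : p = a / n := by rw [hp]; field_simp
  have hp1 : (a : ℝ) / n ≤ 1 := by
    rw [div_le_one hn0]; exact_mod_cast han.le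
  have hp0 : (0 : ℝ) ≤ a / n := by positivity
  have hblind := FloodingAnonymity.one_div_le_optimalPrecision (a := a) hdn han
  have hpow : (1 : ℝ) ≤ (d : ℝ) ^ 120 := one_le_pow₀ hd1
  by_cases ha : a ≤ 1
  · refine le_trans ?_ hblind
    calc 1 / (16 * (d : ℝ) ^ 120) * (a / n) ≤ 1 * (1 / n) := by
          gcongr
          · rw [div_le_one (by positivity)]; linarith
          · exact_mod_cast ha
      _ = 1 / n := one_mul _
  by_cases hn : 16 * d ^ 120 ≤ n
  · by_cases hS : 16 * d * a ≤ n
    · obtain ⟨s, hs, h1, h2⟩ := FloodingAnonymity.exists_scale hd hn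
      refine le_trans ?_ (FloodingAnonymity.mul_le_optimalPrecision hd hs h1 h2 hdn
        (by omega) hS)
      exact mul_le_mul_of_nonneg_right (one_div_le_one_div_of_le (by positivity)
        (mul_le_mul_of_nonneg_left (pow_le_pow_right₀ hd1 (by omega)) (by norm_num))) hp0
    -- Here $p$ is bounded below by $1/(16d)$, so the quadratic bound is linear up to a constant.
    · refine le_trans ?_ (FloodingAnonymity.sq_le_optimalPrecision hd hdn (by omega) han)
      have h1 : 1 / (16 * (d : ℝ)) ≤ a / n := by
        rw [div_le_div_iff₀ (by positivity) hn0]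
        have : (n : ℝ) ≤ 16 * d * a := by exact_mod_cast (not_le.1 hS).le
        linarith
      have h2 : 4 * (16 * (d : ℝ)) ≤ 16 * (d : ℝ) ^ 120 := by
        calc 4 * (16 * (d : ℝ)) = 16 * (2 ^ 2 * (d : ℝ)) := by ring
          _ ≤ 16 * ((d : ℝ) ^ 2 * d) := by gcongr; exact_mod_cast hd
          _ = 16 * (d : ℝ) ^ 3 := by ring
          _ ≤ 16 * (d : ℝ) ^ 120 :=
            mul_le_mul_of_nonneg_left (pow_le_pow_right₀ hd1 (by omega)) (by norm_num)
      calc 1 / (16 * (d : ℝ) ^ 120) * (a / n) ≤ 1 / (4 * (16 * (d : ℝ))) * (a / n) :=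
            mul_le_mul_of_nonneg_right (one_div_le_one_div_of_le (by positivity) h2) hp0
        _ = 1 / 4 * (1 / (16 * (d : ℝ)) * (a / n)) := by rw [← one_div_mul_one_div]; ring
        _ ≤ 1 / 4 * (a / n * (a / n)) := by gcongr
        _ = _ := by ring
  · refine le_trans ?_ hblind
    calc 1 / (16 * (d : ℝ) ^ 120) * ((a : ℝ) / n) ≤ 1 / (16 * (d : ℝ) ^ 120) * 1 :=
          mul_le_mul_of_nonneg_left hp1 (by positivity)
      _ ≤ 1 / (n : ℝ) := by
        rw [mul_one]
        refine one_div_le_one_div_of_le hn0 ?_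
        exact_mod_cast (not_le.1 hn).le
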